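/- Let $\mathbb T^2=\mathbb R^2/\mathbb Z^2$ with Lebesgue measure. Let $H$ be the space of $u\in L^2(\mathbb T^2;\mathbb R^2)$ with $\int_{\mathbb T^2}u\,dx=0$ and $\nabla\cdot u=0$ (in the sense of distributions), with the $L^2$ scalar product $\langle\cdot,\cdot\rangle$ and norm $|\cdot|_H$; let $V=H\cap H^1(\mathbb T^2;\mathbb R^2)$ with the $H^1$ norm and $E=D(A)=H\cap H^2(\mathbb T^2;\mathbb R^2)$ with the $H^2$ norm. Let $A:E\to H$, $Au=-\Delta u$, be the Stokes operator, let $B(u,v)\in H$ be the orthogonal projection onto $H$ of $(u\cdot\nabla)v=\sum_i u^i\,\partial v/\partial x^i$ (so that $\langle B(u,v),\phi\rangle=\sum_{i,j}\int_{\mathbb T^2} u^i\frac{\partial v^j}{\partial x^i}\phi^j\,dx$ for $\phi\in V$), and put $B(u)=B(u,u)$ and $B'(\bar u)\omega=B(\bar u,\omega)+B(\omega,\bar u)$. Below, $|\nabla u|$ and $\langle\nabla u,\nabla v\rangle$ denote the $L^2$ norm and the $L^2$ scalar product of gradients. For $T>0$ let $X_T=C([0,T];V)\cap L^2(0,T;E)$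 with the norm $|\omega|_{X_T}=\max\big(\sup_{t}|\omega(t)|_V,\,(\int_0^T|\omega(t)|_E^2\,dt)^{1/2}\big)$. Then $(u\cdot\nabla)v\in L^2(\mathbb T^2;\mathbb R^2)$ for all $u,v\in E$, and the following hold for every steady state $\bar u$, that is, every $\bar u\in E$ with $A\bar u+B(\bar u)-|\nabla\bar u|^2\bar u=0$. 1. There are constants $C_1,C_2,C_3>0$, independent of $\bar u$, $T$ and $U$, such that for every $T>0$ and every $U\in L^2(0,T;H)$ the map $$\omega\mapsto G(\omega)=U-B'(\bar u)\omega+|\nabla\bar u|^2\omega+2\langle\nabla\bar u,\nabla\omega\rangle\bar u$$ is well defined from $X_T$ to $L^2(0,T;H)$ and globally Lipschitz: for all $\omega_1,\omega_2\in X_T$, $$|G(\omega_1)-G(\omega_2)|_{L^2(0,T;H)}\le\big(C_1|\nabla\bar u|^2+C_2|\bar u|_E+2C_3|\bar u|_H|\nabla\bar u|\big)\,|\omega_1-\omega_2|_{X_T}.$$ 2. The linearized system has a unique global solution: for every $T>0$, every $U\in L^2(0,T;H)$ and every $\omega_0\in V$ there is exactly one $\omega\in X_T$ with $\omega(0)=\omega_0$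 which is absolutely continuous in $H$ with derivative $\omega_t\in L^2(0,T;H)$ and satisfies $$\omega_t+A\omega+B'(\bar u)\omega-|\nabla\bar u|^2\omega-2\langle\nabla\bar u,\nabla\omega\rangle\bar u=U$$ in $H$ for almost every $t\in(0,T)$. Likewise, if $U:[0,\infty)\to H$ is square integrable on $[0,T]$ for every $T>0$, there is exactly one continuous $\omega:[0,\infty)\to V$ whose restriction to $[0,T]$ is, for every $T>0$, an element of $X_T$ and a solution in this sense. -/

import Mathlib

noncomputable section

namespace CNS

open MeasureTheory Set

/-! ### The flat torus and smooth functions on it -/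

/-- The flat two-dimensional torus `ℝ² / ℤ²`. -/
abbrev Torus : Type := UnitAddTorus (Fin 2)

/-- Lebesgue measure on the torus (of total mass one). -/
abbrev torusMeasure : Measure Torus := Measure.pi fun _ : Fin 2 => AddCircle.haarAddCircle

/-- The covering map `ℝ² → ℝ² / ℤ²`. -/
def cover (x : Fin 2 → ℝ) : Torus := fun i => (x i : UnitAddCircle)

/-- A function on the torus is smooth if its periodic lift to `ℝ²` is. -/
def IsSmooth (φ : Torus → ℝ) : Prop := ContDiff ℝ (⊤ : ℕ∞) fun x : Fin 2 → ℝ => φ (cover x)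

/-- The classical partial derivative `∂φ/∂xⁱ` of a function on the torus. -/
def pd (i : Fin 2) (φ : Torus → ℝ) (p : Torus) : ℝ :=
  deriv (fun s : ℝ => φ (p + Pi.single i (s : UnitAddCircle))) 0

/-! ### Vector fields and weak derivatives -/

abbrev Vec : Type := EuclideanSpace ℝ (Fin 2)

/-- `L²(𝕋²; ℝ²)`. -/
abbrev L2 : Type := Lp Vec 2 torusMeasure

/-- `g` is the weak partial derivative `∂u/∂xⁱ` of the vector field `u`. -/
def HasWeakPartial (i : Fin 2) (u g : L2) : Prop :=
  ∀ φ : Torus → ℝ, IsSmooth φ → ∀ j : Fin 2,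
    ∫ x, u x j * pd i φ x ∂torusMeasure = - ∫ x, g x j * φ x ∂torusMeasure

/-- `∇ · u = 0` in the sense of distributions. -/
def IsDivFree (u : L2) : Prop :=
  ∀ φ : Torus → ℝ, IsSmooth φ → ∑ j : Fin 2, ∫ x, u x j * pd j φ x ∂torusMeasure = 0

/-- `∫ u dx = 0`. -/
def HasMeanZero (u : L2) : Prop := ∀ j : Fin 2, ∫ x, u x j ∂torusMeasure = 0

/-! ### Auxiliary facts -/

lemma cover_surjective (p : Torus) : ∃ x, cover x = p := by
  choose x hx using fun i => QuotientAddGroup.mk_surjective (p i)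
  exact ⟨x, funext hx⟩

lemma isOpenQuotientMap_cover : IsOpenQuotientMap cover := by
  have h : cover = Pi.map (fun _ : Fin 2 => ((↑) : ℝ → UnitAddCircle)) := rfl
  rw [h]
  exact IsOpenQuotientMap.piMap fun _ => QuotientAddGroup.isOpenQuotientMap_mk

lemma IsSmooth.continuous {φ : Torus → ℝ} (h : IsSmooth φ) : Continuous φ :=
  isOpenQuotientMap_cover.isQuotientMap.continuous_iff.2 (ContDiff.continuous h)

lemma pd_cover {φ : Torus → ℝ} (h : IsSmooth φ) (i : Fin 2) (x : Fin 2 → ℝ) :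
    pd i φ (cover x) = fderiv ℝ (fun y => φ (cover y)) x (Pi.single i 1) := by
  have hd : DifferentiableAt ℝ (fun y => φ (cover y)) x :=
    (ContDiff.differentiable h (by simp)).differentiableAt
  have he : (fun s : ℝ => φ (cover x + Pi.single i (s : UnitAddCircle)))
      = fun s : ℝ => φ (cover (x + s • Pi.single i (1 : ℝ))) := by
    funext s
    congr 1
    funext j
    by_cases hj : j = i
    · subst hj; simp [cover]
    · simp [cover, hj]
  unfold pd
  rw [he]
  exact (hd.hasFDerivAt.hasLineDerivAt (Pi.single i 1)).lineDeriv

lemma IsSmooth.pd {φ : Torus → ℝ} (h : IsSmooth φ) (i : Fin 2) : IsSmooth (pd i φ) := by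
  unfold IsSmooth
  simp only [pd_cover h i]
  exact (ContDiff.fderiv_right (m := (⊤ : ℕ∞)) h (by simp)).clm_apply contDiff_const

lemma pd_comm {φ : Torus → ℝ} (h : IsSmooth φ) (i j : Fin 2) :
    pd i (pd j φ) = pd j (pd i φ) := by
  have key : ∀ (a b : Fin 2) (x : Fin 2 → ℝ), pd a (pd b φ) (cover x)
      = fderiv ℝ (fderiv ℝ fun y => φ (cover y)) x (Pi.single a 1) (Pi.single b 1) := by
    intro a b x
    rw [pd_cover (h.pd b) a]
    simp only [pd_cover h b]
    have hd : DifferentiableAt ℝ (fderiv ℝ fun y => φ (cover y)) x :=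
      ((ContDiff.fderiv_right (m := (⊤ : ℕ∞)) h (by simp)).differentiable (by simp)).differentiableAt
    rw [fderiv_clm_apply hd (differentiableAt_const _)]
    simp
  funext p
  obtain ⟨x, rfl⟩ := cover_surjective p
  rw [key, key]
  have hs : IsSymmSndFDerivAt ℝ (fun y => φ (cover y)) x :=
    (ContDiff.contDiffAt h).isSymmSndFDerivAt (by
      rw [minSmoothness_of_isRCLikeNormedField]; exact WithTop.coe_le_coe.2 le_top)
  exact hs _ _

lemma isSmooth_one : IsSmooth fun _ => 1 := contDiff_const

lemma pd_one (i : Fin 2) : pd i (fun _ => 1) = 0 := by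
  funext p; simp [pd]

/-- The continuous linear functional `u ↦ ∫ uʲ ψ dx`. -/
def pairing (j : Fin 2) (ψ : C(Torus, ℝ)) : L2 →L[ℝ] ℝ :=
  innerSL ℝ (ContinuousMap.toLp (E := Vec) 2 torusMeasure ℝ
    ⟨fun x => ψ x • EuclideanSpace.single j (1 : ℝ), by fun_prop⟩)

lemma pairing_apply (j : Fin 2) (ψ : C(Torus, ℝ)) (u : L2) :
    pairing j ψ u = ∫ x, u x j * ψ x ∂torusMeasure := by
  simp only [pairing, innerSL_apply_apply, L2.inner_def]
  refine integral_congr_ae ?_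
  filter_upwards [ContinuousMap.coeFn_toLp (E := Vec) (p := 2) (𝕜 := ℝ) torusMeasure
    ⟨fun x => ψ x • EuclideanSpace.single j (1 : ℝ), by fun_prop⟩] with x hx
  rw [hx]
  simp [real_inner_smul_left, EuclideanSpace.inner_single_left, mul_comm]

lemma hasWeakPartial_iff (i : Fin 2) (u g : L2) :
    HasWeakPartial i u g ↔ ∀ (φ : Torus → ℝ) (h : IsSmooth φ) (j : Fin 2),
      pairing j ⟨_, (h.pd i).continuous⟩ u + pairing j ⟨φ, h.continuous⟩ g = 0 := by
  simp only [HasWeakPartial, pairing_apply, ContinuousMap.coe_mk, eq_neg_iff_add_eq_zero]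

lemma isDivFree_iff (u : L2) :
    IsDivFree u ↔ ∀ (φ : Torus → ℝ) (h : IsSmooth φ),
      ∑ j : Fin 2, pairing j ⟨_, (h.pd j).continuous⟩ u = 0 := by
  simp only [IsDivFree, pairing_apply, ContinuousMap.coe_mk]

lemma hasMeanZero_iff (u : L2) : HasMeanZero u ↔ ∀ j : Fin 2, pairing j 1 u = 0 := by
  simp only [HasMeanZero, pairing_apply, ContinuousMap.one_apply, mul_one]

lemma HasWeakPartial.add {i : Fin 2} {u u' g g' : L2} (h : HasWeakPartial i u g)
    (h' : HasWeakPartial i u' g') : HasWeakPartial i (u + u') (g + g') := by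
  rw [hasWeakPartial_iff] at *
  intro φ hφ j
  have h1 := h φ hφ j
  have h2 := h' φ hφ j
  simp only [map_add]
  linarith

lemma HasWeakPartial.smul {i : Fin 2} {u g : L2} (c : ℝ) (h : HasWeakPartial i u g) :
    HasWeakPartial i (c • u) (c • g) := by
  rw [hasWeakPartial_iff] at *
  intro φ hφ j
  simp only [map_smul, ← smul_add, h φ hφ j, smul_zero]

lemma HasWeakPartial.zero (i : Fin 2) : HasWeakPartial i 0 0 := by
  rw [hasWeakPartial_iff]; intros; simp

/-! ### The spaces `H`, `V` and `E = D(A)` -/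

/-- The closed subspace of `L²(𝕋²; ℝ²)` of vector fields with mean zero and zero divergence. -/
def solenoidal : Submodule ℝ L2 where
  carrier := {u | HasMeanZero u ∧ IsDivFree u}
  add_mem' := by
    rintro u v ⟨hu, hu'⟩ ⟨hv, hv'⟩
    simp only [mem_ofPred_eq, hasMeanZero_iff, isDivFree_iff] at *
    refine ⟨fun j => by rw [map_add, hu, hv, add_zero], fun φ h => ?_⟩
    simp only [map_add, Finset.sum_add_distrib, hu' φ h, hv' φ h, add_zero]
  zero_mem' := by
    simp only [mem_ofPred_eq, hasMeanZero_iff, isDivFree_iff]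
    simp
  smul_mem' := by
    rintro c u ⟨hu, hu'⟩
    simp only [mem_ofPred_eq, hasMeanZero_iff, isDivFree_iff] at *
    refine ⟨fun j => by rw [map_smul, hu, smul_zero], fun φ h => ?_⟩
    simp only [map_smul, ← Finset.smul_sum, hu' φ h, smul_zero]

lemma isClosed_solenoidal : IsClosed (solenoidal : Set L2) := by
  have : (solenoidal : Set L2) = {u | (∀ j : Fin 2, pairing j 1 u = 0) ∧
      ∀ (φ : Torus → ℝ) (h : IsSmooth φ),
        ∑ j : Fin 2, pairing j ⟨_, (h.pd j).continuous⟩ u = 0} := by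
    ext u
    simp only [mem_ofPred_eq, ← hasMeanZero_iff, ← isDivFree_iff]
    rfl
  rw [this]
  simp only [ofPred_and, ofPred_forall]
  refine IsClosed.inter (isClosed_iInter fun j => isClosed_eq (by fun_prop) (by fun_prop))
    (isClosed_iInter fun φ => isClosed_iInter fun h => isClosed_eq (by fun_prop) (by fun_prop))

instance : CompleteSpace solenoidal := isClosed_solenoidal.completeSpace_coe

/-- The space `H` of square integrable vector fields with mean zero and zero divergence, with the
`L²` scalar product. -/
def H : Type := solenoidal

instance : NormedAddCommGroup H := inferInstanceAs (NormedAddCommGroup solenoidal)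
instance : InnerProductSpace ℝ H := inferInstanceAs (InnerProductSpace ℝ solenoidal)
instance : CompleteSpace H := inferInstanceAs (CompleteSpace solenoidal)

/-- The inclusion `H ⊂ L²(𝕋²; ℝ²)`. -/
def H.toL2 : H →L[ℝ] L2 := solenoidal.subtypeL

/-- The orthogonal projection of `L²(𝕋²; ℝ²)` onto `H`. -/
def H.proj : L2 →L[ℝ] H := solenoidal.orthogonalProjectionOnto

/-- Pairs of `L²` vector fields `(∂u/∂x¹, ∂u/∂x²)`, with the Hilbert norm. -/
abbrev Grads : Type := PiLp 2 fun _ : Fin 2 => L2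

/-- Quadruples of `L²` vector fields, with the Hilbert norm. -/
abbrev Hessians : Type := PiLp 2 fun _ : Fin 2 × Fin 2 => L2

/-- The graph of the weak gradient on `H¹ ∩ H`. -/
def graphV : Submodule ℝ (WithLp 2 (H × Grads)) where
  carrier := {w | ∀ i, HasWeakPartial i (H.toL2 w.fst) (w.snd i)}
  add_mem' := fun {_ _} hu hv i => (hu i).add (hv i)
  zero_mem' := fun i => HasWeakPartial.zero i
  smul_mem' := fun c _ hu i => (hu i).smul c

/-- The space `V = H¹ ∩ H`. An element of `V` is listed together with its two weak first partial
derivatives (which are determined by it), so that the inherited norm is the `H¹` norm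
`(|u|² + |∇u|²)^{1/2}`. -/
def V : Type := graphV

instance : NormedAddCommGroup V := inferInstanceAs (NormedAddCommGroup graphV)
instance : InnerProductSpace ℝ V := inferInstanceAs (InnerProductSpace ℝ graphV)

/-- The inclusion `V ⊂ H`. -/
def V.toH : V →L[ℝ] H := (WithLp.fstL 2 ℝ H Grads).comp graphV.subtypeL

/-- The gradient of `u ∈ V`: its `i`-th component is the vector field `∂u/∂xⁱ`. The norm and
inner product of the target are `|∇u|` and `⟨∇u, ∇v⟩` in `L²`. -/
def V.grad : V →L[ℝ] Grads := (WithLp.sndL 2 ℝ H Grads).comp graphV.subtypeL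

/-- The graph of the weak second derivatives on `H² ∩ H`. -/
def graphE : Submodule ℝ (WithLp 2 (V × Hessians)) where
  carrier := {w | ∀ i j, HasWeakPartial i (V.grad w.fst j) (w.snd (i, j))}
  add_mem' := fun {_ _} hu hv i j => (hu i j).add (hv i j)
  zero_mem' := fun i _ => HasWeakPartial.zero i
  smul_mem' := fun c _ hu i j => (hu i j).smul c

/-- The space `E = D(A) = H² ∩ H`. An element is listed together with its weak first and second
partial derivatives; the entry `(i, j)` of the latter is `∂/∂xⁱ (∂u/∂xʲ)`. The inherited norm is
the `H²` norm. -/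
def E : Type := graphE

instance : NormedAddCommGroup E := inferInstanceAs (NormedAddCommGroup graphE)
instance : InnerProductSpace ℝ E := inferInstanceAs (InnerProductSpace ℝ graphE)

/-- The inclusion `E ⊂ V`. -/
def E.toV : E →L[ℝ] V := (WithLp.fstL 2 ℝ V Hessians).comp graphE.subtypeL

/-- The inclusion `E ⊂ H`. -/
def E.toH : E →L[ℝ] H := V.toH.comp E.toV

/-- The gradient of an element of `E`. -/
def E.grad : E →L[ℝ] Grads := V.grad.comp E.toV

/-- The second derivative `∂/∂xⁱ (∂u/∂xʲ)`. -/
def E.hess (i j : Fin 2) : E →L[ℝ] L2 :=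
  (PiLp.proj 2 (fun _ : Fin 2 × Fin 2 => L2) (i, j)).comp
    ((WithLp.sndL 2 ℝ V Hessians).comp graphE.subtypeL)

/-! ### The Stokes operator and the bilinear map `B` -/

lemma H.isDivFree (u : H) : IsDivFree (H.toL2 u) := u.2.2

lemma V.weak (u : V) (i : Fin 2) : HasWeakPartial i (H.toL2 (V.toH u)) (V.grad u i) := u.2 i

lemma E.weak (u : E) (i j : Fin 2) : HasWeakPartial i (E.grad u j) (E.hess i j u) := u.2 i j

/-- `-Δ : E → L²`. -/
def negLaplacian : E →L[ℝ] L2 := - ∑ i : Fin 2, E.hess i i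

lemma pairing_hess (u : E) (i j : Fin 2) (φ : Torus → ℝ) (h : IsSmooth φ) :
    pairing j ⟨φ, h.continuous⟩ (E.hess i i u)
      = pairing j ⟨_, ((h.pd i).pd i).continuous⟩ (H.toL2 (E.toH u)) := by
  have e1 := (hasWeakPartial_iff _ _ _).1 (E.weak u i i) φ h j
  have e2 : pairing j ⟨_, ((h.pd i).pd i).continuous⟩ (H.toL2 (E.toH u))
      + pairing j ⟨_, (h.pd i).continuous⟩ (E.grad u i) = 0 :=
    (hasWeakPartial_iff _ _ _).1 (V.weak (E.toV u) i) _ (h.pd i) j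
  linarith

lemma negLaplacian_apply (u : E) :
    negLaplacian u = -(E.hess 0 0 u + E.hess 1 1 u) := by
  simp only [negLaplacian, Fin.sum_univ_two]
  rfl

lemma negLaplacian_mem (u : E) : negLaplacian u ∈ solenoidal := by
  rw [negLaplacian_apply]
  refine solenoidal.neg_mem (solenoidal.add_mem ?_ ?_)
  all_goals
    constructor
    · rw [hasMeanZero_iff]
      intro j
      have h1 : (1 : C(Torus, ℝ)) = ⟨fun _ => 1, isSmooth_one.continuous⟩ := rfl
      rw [h1, pairing_hess u _ j _ isSmooth_one, pairing_apply]
      have h0 : ∀ i, pd i (pd i fun _ => 1) = 0 := by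
        intro i; funext p; simp [pd]
      simp only [ContinuousMap.coe_mk, h0, Pi.zero_apply, mul_zero, integral_zero]
    · rw [isDivFree_iff]
      intro φ h
      have hd := (isDivFree_iff _).1 (H.isDivFree (E.toH u))
      have key : ∀ i, ∑ j : Fin 2, pairing j ⟨_, (h.pd j).continuous⟩ (E.hess i i u) = 0 := by
        intro i
        rw [← hd _ ((h.pd i).pd i)]
        refine Finset.sum_congr rfl fun j _ => ?_
        rw [pairing_hess u i j _ (h.pd j)]
        have hc : pd i (pd i (pd j φ)) = pd j (pd i (pd i φ)) := by
          rw [pd_comm h i j, pd_comm (h.pd i) i j]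
        simp only [hc]
      exact key _

/-- The Stokes operator `A u = -Δ u`, `A : D(A) → H`. -/
def A : E →L[ℝ] H := negLaplacian.codRestrict solenoidal negLaplacian_mem

/-- The vector field `(u · ∇) v = ∑ᵢ uⁱ ∂v/∂xⁱ`, for `u, v ∈ V`. -/
def convection (u v : V) (x : Torus) : Vec :=
  ∑ i : Fin 2, H.toL2 (V.toH u) x i • V.grad v i x

open Classical in
/-- The orthogonal projection of `L²(𝕋²; ℝ²)` onto `H`, applied to a square integrable vector
field. -/
def leray (f : Torus → Vec) : H :=
  if h : MemLp f 2 torusMeasure then H.proj (h.toLp f) else 0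

/-- The bilinear map `B : V × E → H`, `⟨B(u, v), φ⟩ = ∑ᵢⱼ ∫ uⁱ (∂vʲ/∂xⁱ) φʲ dx`. -/
def B (u : V) (v : E) : H := leray (convection u (E.toV v))

/-- The derivative `B'(ū) ω = B(ū, ω) + B(ω, ū)` of `u ↦ B(u, u)` at `ū`. -/
def B' (ubar ω : E) : H := B (E.toV ubar) ω + B (E.toV ω) ubar

/-- `A ū + B(ū) - |∇ū|² ū = 0`. -/
def IsSteadyState (ubar : E) : Prop :=
  A ubar + B (E.toV ubar) ubar - ‖E.grad ubar‖ ^ 2 • E.toH ubar = 0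

/-! ### Spaces of time dependent fields -/

/-- Lebesgue measure on `[0, T]`. -/
abbrev timeMeasure (T : ℝ) : Measure (Icc (0 : ℝ) T) := volume.comap Subtype.val

/-- `L²(0, T; F)`. -/
abbrev L2Time (T : ℝ) (F : Type) [NormedAddCommGroup F] : Type := Lp F 2 (timeMeasure T)

/-- Pairs of a continuous `V`-valued path and an element of `L²(0, T; E)` which agree at almost
every time. -/
def graphX (T : ℝ) : Submodule ℝ (C(Icc (0 : ℝ) T, V) × L2Time T E) where
  carrier := {w | ∀ᵐ t ∂timeMeasure T, E.toV (w.2 t) = w.1 t}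
  add_mem' := by
    intro a b ha hb
    simp only [mem_ofPred_eq] at *
    filter_upwards [ha, hb, Lp.coeFn_add a.2 b.2] with t h1 h2 h3
    change E.toV ((a.2 + b.2 : L2Time T E) t) = a.1 t + b.1 t
    rw [h3, Pi.add_apply, map_add, h1, h2]
  zero_mem' := by
    simp only [mem_ofPred_eq]
    filter_upwards [Lp.coeFn_zero E 2 (timeMeasure T)] with t h
    change E.toV ((0 : L2Time T E) t) = 0
    rw [h, Pi.zero_apply, map_zero]
  smul_mem' := by
    intro c a ha
    simp only [mem_ofPred_eq] at *
    filter_upwards [ha, Lp.coeFn_smul c a.2] with t h1 h2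
    change E.toV ((c • a.2 : L2Time T E) t) = c • a.1 t
    rw [h2, Pi.smul_apply, map_smul, h1]

/-- `X_T = C([0, T]; V) ∩ L²(0, T; E)`: continuous `V`-valued paths, listed together with the
element of `L²(0, T; E)` with which they agree at almost every time. The inherited norm is
`max (sup_t |ω(t)|_V) (∫ |ω(t)|_E² dt)^{1/2}`. -/
def X (T : ℝ) : Type := graphX T

instance (T : ℝ) : NormedAddCommGroup (X T) := inferInstanceAs (NormedAddCommGroup (graphX T))
instance (T : ℝ) : NormedSpace ℝ (X T) := inferInstanceAs (NormedSpace ℝ (graphX T))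

/-- The continuous `V`-valued path of `ω ∈ X_T`. -/
def X.path {T : ℝ} (ω : X T) : C(Icc (0 : ℝ) T, V) := ω.1.1

/-- `ω ∈ X_T` as an element of `L²(0, T; E)`. -/
def X.toE {T : ℝ} (ω : X T) : L2Time T E := ω.1.2

/-- `G(ω) = U - B'(ū) ω + |∇ū|² ω + 2 ⟨∇ū, ∇ω⟩ ū`, at a fixed time. -/
def G (ubar : E) (U : H) (ω : E) : H :=
  U - B' ubar ω + ‖E.grad ubar‖ ^ 2 • E.toH ω
    + (2 * inner ℝ (E.grad ubar) (E.grad ω)) • E.toH ubar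

/-- `w ∈ L²(0, T; H)` is the time derivative `ω_t`: `ω` is absolutely continuous in `H` with
density `w`. -/
def HasTimeDeriv {T : ℝ} (ω : C(Icc (0 : ℝ) T, V)) (w : L2Time T H) : Prop :=
  ∀ s t : Icc (0 : ℝ) T, s ≤ t → V.toH (ω t) - V.toH (ω s) = ∫ r in Ioc s t, w r ∂timeMeasure T

/-- `ω ∈ X_T` solves `ω_t + A ω + B'(ū) ω - |∇ū|² ω - 2 ⟨∇ū, ∇ω⟩ ū = U` on `(0, T)`, with
`ω_t ∈ L²(0, T; H)` and `ω(0) = ω₀`. -/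
def IsLinearizedSolution (ubar : E) {T : ℝ} (hT : 0 < T) (U : L2Time T H) (ω₀ : V) (ω : X T) :
    Prop :=
  ω.path ⟨0, left_mem_Icc.2 hT.le⟩ = ω₀ ∧
    ∃ w : L2Time T H, HasTimeDeriv ω.path w ∧
      ∀ᵐ t ∂timeMeasure T, w t + A (ω.toE t) + B' ubar (ω.toE t) - ‖E.grad ubar‖ ^ 2 • E.toH (ω.toE t)
        - (2 * inner ℝ (E.grad ubar) (E.grad (ω.toE t))) • E.toH ubar = U t

end CNS

end

open CNS MeasureTheory Set

noncomputable section

namespace CNS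

open MeasureTheory Set UnitAddTorus

/-! ### The Hartley functions `cas_k = cos (2π k·x) + sin (2π k·x)` -/

/-! Two estimates carry the proof. Write `L ω = -B'(ū)ω + |∇ū|²ω + 2⟨∇ū,∇ω⟩ū`.

First, `L` is bounded from `E` to `H`, so that `G(ω) = U + Lω` is affine and the Lipschitz bound is
the bound on `L`. Moreover `L` is small relative to `A + μ`: for large `μ = m²` one has `|Lω| ≤ ½
|(A + μ)ω|` (`exists_norm_lowerOrder_le`). The `H` norm and the gradient gain factors `m⁻²` and
`m⁻¹` against `|(A + m²)ω|`. The term `B(ω, ū)` needs the sup norm of `ω`; Cauchy–Schwarz on the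
Fourier side bounds it by a constant times `(∑ |k|⁻³ / m)^{1/2} |(A + m²)ω|` (`ae_norm_le`).

Second, a solution of `ω_t + Aω = f` with `ω(0) = 0` satisfies `|e^{-μt}(A + μ)ω| ≤ |e^{-μt} f|` in
`L²(0,T;H)`, with constant exactly one (`IsStokesSolution.norm_weight_shiftedPath_le`). This is a
scalar energy inequality in each eigenmode, summed by Parseval.

Together they make `f ↦ U + L(sol f)`, where `sol f` is the Stokes solution with right-hand side `f`
and initial value `ω₀`, a contraction of ratio ½ in the weighted `L²(0,T;H)`, on the whole of
`[0,T]` at once, without gluing short intervals. Applied to a difference of solutions, the same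
inequalities give uniqueness; uniqueness makes the solutions for different `T` agree, hence the
half-line statement.

The Fourier analysis is done over the reals with the functions `cas_k`. A derivative multiplies by
`±2πk_i` and flips `k` to `-k`, second derivatives are diagonal, and norm comparisons reduce to
comparing multipliers. In `H` the zero frequency is absent and each other frequency leaves only the
direction `k^⊥`, which gives the eigenbasis of `A`. -/

/-- Frequencies of Fourier series on the torus. -/
abbrev Freq : Type := Fin 2 → ℤ

/-- The Hartley function `cos (2π k·x) + sin (2π k·x)`. -/
def cas (k : Freq) : C(Torus, ℝ) where
  toFun x := (mFourier k x).re + (mFourier k x).im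
  continuous_toFun := by fun_prop

lemma cas_apply (k : Freq) (x : Torus) : cas k x = (mFourier k x).re + (mFourier k x).im := rfl

lemma cas_neg_apply (k : Freq) (x : Torus) :
    cas (-k) x = (mFourier k x).re - (mFourier k x).im := by
  rw [cas_apply, mFourier_neg, Complex.conj_re, Complex.conj_im, sub_eq_add_neg]

lemma mFourier_cover (k : Freq) (x : Fin 2 → ℝ) :
    mFourier k (cover x) = Complex.exp ((2 * Real.pi * (k 0 * x 0 + k 1 * x 1) : ℝ) * Complex.I) := by
  simp only [mFourier, cover, ContinuousMap.coe_mk, Fin.prod_univ_two, fourier_coe_apply,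
    ← Complex.exp_add]
  congr 1
  push_cast
  ring

lemma cas_cover (k : Freq) (x : Fin 2 → ℝ) :
    cas k (cover x) = Real.cos (2 * Real.pi * (k 0 * x 0 + k 1 * x 1))
      + Real.sin (2 * Real.pi * (k 0 * x 0 + k 1 * x 1)) := by
  rw [cas_apply, mFourier_cover, Complex.exp_ofReal_mul_I_re, Complex.exp_ofReal_mul_I_im]

lemma isSmooth_cas (k : Freq) : IsSmooth (cas k) := by
  unfold IsSmooth
  simp only [cas_cover]
  fun_prop

lemma pd_cas (i : Fin 2) (k : Freq) (p : Torus) :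
    pd i (cas k) p = 2 * Real.pi * k i * cas (-k) p := by
  obtain ⟨x, rfl⟩ := cover_surjective p
  have he : (fun s : ℝ => cas k (cover x + Pi.single i (s : UnitAddCircle)))
      = fun s : ℝ => Real.cos (2 * Real.pi * (k 0 * x 0 + k 1 * x 1) + 2 * Real.pi * k i * s)
        + Real.sin (2 * Real.pi * (k 0 * x 0 + k 1 * x 1) + 2 * Real.pi * k i * s) := by
    funext s
    have : cover x + Pi.single i (s : UnitAddCircle) = cover (x + Pi.single i s) := by
      funext j
      by_cases hj : j = i
      · subst hj; simp [cover]
      · simp [cover, hj]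
    rw [this, cas_cover]
    fin_cases i <;> simp <;> ring_nf
  unfold pd
  rw [he]
  set a := 2 * Real.pi * (k 0 * x 0 + k 1 * x 1)
  have hl : HasDerivAt (fun s : ℝ => a + 2 * Real.pi * k i * s) (2 * Real.pi * k i) 0 := by
    simpa using ((hasDerivAt_id (0 : ℝ)).const_mul (2 * Real.pi * k i)).const_add a
  have hd : HasDerivAt (fun s : ℝ => Real.cos (a + 2 * Real.pi * k i * s)
      + Real.sin (a + 2 * Real.pi * k i * s)) _ 0 := hl.cos.add hl.sin
  rw [hd.deriv, cas_neg_apply, mFourier_cover, Complex.exp_ofReal_mul_I_re,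
    Complex.exp_ofReal_mul_I_im]
  simp only [mul_zero, add_zero]
  ring

lemma norm_mFourier_apply (k : Freq) (x : Torus) : ‖mFourier k x‖ = 1 := by
  obtain ⟨x, rfl⟩ := cover_surjective x
  rw [mFourier_cover, Complex.norm_exp_ofReal_mul_I]

lemma abs_cas_le (k : Freq) (x : Torus) : |cas k x| ≤ 2 := by
  have h1 := Complex.abs_re_le_norm (mFourier k x)
  have h2 := Complex.abs_im_le_norm (mFourier k x)
  rw [norm_mFourier_apply] at h1 h2
  exact (abs_add_le _ _).trans (by linarith)

lemma integral_mFourier (k : Freq) :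
    ∫ x, mFourier k x ∂torusMeasure = if k = 0 then 1 else 0 := by
  have h := (orthonormal_iff_ite.1 (orthonormal_mFourier (d := Fin 2))) 0 k
  rw [ContinuousMap.inner_toLp] at h
  simpa [mFourier_zero, eq_comm] using! h

lemma integrable_of_continuous (f : C(Torus, ℝ)) : Integrable f torusMeasure :=
  f.continuous.integrable_of_hasCompactSupport (HasCompactSupport.of_compactSpace _)

lemma integrable_mFourier (k : Freq) : Integrable (mFourier k) torusMeasure :=
  (mFourier k).continuous.integrable_of_hasCompactSupport (HasCompactSupport.of_compactSpace _)

lemma cas_mul_cas (k l : Freq) (x : Torus) :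
    cas k x * cas l x = (mFourier (k - l) x).re + (mFourier (k + l) x).im := by
  rw [sub_eq_add_neg, mFourier_add, mFourier_add, mFourier_neg]
  simp only [cas_apply, Complex.mul_re, Complex.mul_im, Complex.conj_re, Complex.conj_im]
  ring

/-- The product is the real part of the character `k - l` plus the imaginary part of the character
`k + l`. Characters have integral 0 or 1, so the imaginary part never contributes. -/
lemma integral_cas_mul_cas (k l : Freq) :
    ∫ x, cas k x * cas l x ∂torusMeasure = if k = l then 1 else 0 := by
  simp only [cas_mul_cas]
  have h1 : ∫ x, (mFourier (k - l) x).re ∂torusMeasure = if k = l then 1 else 0 := by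
    have := integral_re (𝕜 := ℂ) (integrable_mFourier (k - l))
    simp only [RCLike.re_eq_complex_re, integral_mFourier, sub_eq_zero] at this
    rw [this]; split_ifs <;> simp
  have h2 : ∫ x, (mFourier (k + l) x).im ∂torusMeasure = 0 := by
    have := integral_im (𝕜 := ℂ) (integrable_mFourier (k + l))
    simp only [RCLike.im_eq_complex_im, integral_mFourier] at this
    rw [this]; split_ifs <;> simp
  have h3 := integral_add (integrable_mFourier (k - l)).re (integrable_mFourier (k + l)).im
  simp only [RCLike.re_eq_complex_re, RCLike.im_eq_complex_im, h1, h2, add_zero] at h3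
  exact h3

/-- The vector field `cas_k e_j`. -/
def hartleyField (p : Fin 2 × Freq) : C(Torus, Vec) :=
  ⟨fun x => cas p.2 x • EuclideanSpace.single p.1 (1 : ℝ), by fun_prop⟩

/-- The vector field `cas_k e_j` in `L²`. -/
def hartley (p : Fin 2 × Freq) : L2 := ContinuousMap.toLp (E := Vec) 2 torusMeasure ℝ (hartleyField p)

/-- The Hartley coefficient `∫ uʲ cas_k dx`. -/
abbrev coef (j : Fin 2) (k : Freq) : L2 →L[ℝ] ℝ := pairing j (cas k)

lemma inner_hartley (j : Fin 2) (k : Freq) (u : L2) : inner ℝ (hartley (j, k)) u = coef j k u := rfl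

lemma coef_hartley (i j : Fin 2) (k l : Freq) :
    coef i k (hartley (j, l)) = if (i, k) = (j, l) then 1 else 0 := by
  rw [pairing_apply]
  have : ∀ᵐ x ∂torusMeasure, hartley (j, l) x i * cas k x
      = (if i = j then 1 else 0) * (cas k x * cas l x) := by
    filter_upwards [ContinuousMap.coeFn_toLp (E := Vec) (p := 2) (𝕜 := ℝ) torusMeasure
      (hartleyField (j, l))] with x hx
    unfold hartley
    rw [hx]
    simp only [hartleyField, ContinuousMap.coe_mk, PiLp.smul_apply, PiLp.single_apply,
      smul_eq_mul]
    ring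
  rw [integral_congr_ae this, integral_const_mul, integral_cas_mul_cas]
  simp only [Prod.mk.injEq]
  split_ifs <;> simp_all

lemma orthonormal_hartley : Orthonormal ℝ hartley := by
  rw [orthonormal_iff_ite]
  rintro ⟨i, k⟩ ⟨j, l⟩
  rw [inner_hartley, coef_hartley]

lemma memLp_coord (u : L2) (j : Fin 2) : MemLp (fun x => u x j) 2 torusMeasure :=
  (Lp.memLp u).of_le_mul (c := 1)
    ((PiLp.continuous_apply 2 (fun _ : Fin 2 => ℝ) j).comp_aestronglyMeasurable
      (Lp.memLp u).aestronglyMeasurable)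
    (ae_of_all _ fun x => by simpa using PiLp.norm_apply_le (u x) j)

/-- Completeness is inherited from the complex Fourier basis: half the sum and half the difference
of `cas_k` and `cas_{-k}` are the cosine and the sine, so all complex Fourier coefficients of the
component vanish. -/
lemma coord_eq_zero_of_coef {u : L2} {j : Fin 2} (h : ∀ k, coef j k u = 0) :
    ∀ᵐ x ∂torusMeasure, u x j = 0 := by
  have hm := memLp_coord u j
  have hc : MemLp (fun x => ((u x j : ℝ) : ℂ)) 2 torusMeasure := hm.ofReal
  have hi : Integrable (fun x => u x j) torusMeasure := hm.integrable (by norm_num)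
  have hib : ∀ k, Integrable (fun x => u x j * cas k x) torusMeasure := fun k =>
    hi.mul_bdd (c := 2) (cas k).continuous.aestronglyMeasurable (ae_of_all _ (abs_cas_le k))
  have hre : ∀ k, ∫ x, u x j * (mFourier k x).re ∂torusMeasure = 0 := by
    intro k
    have e : ∀ x, u x j * (mFourier k x).re
        = 2⁻¹ * (u x j * cas k x + u x j * cas (-k) x) := by
      intro x; rw [cas_neg_apply, cas_apply]; ring
    simp only [e, integral_const_mul]
    rw [integral_add (hib _) (hib _), ← pairing_apply, ← pairing_apply, h, h]; simp
  have him : ∀ k, ∫ x, u x j * (mFourier k x).im ∂torusMeasure = 0 := by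
    intro k
    have e : ∀ x, u x j * (mFourier k x).im
        = 2⁻¹ * (u x j * cas k x - u x j * cas (-k) x) := by
      intro x; rw [cas_neg_apply, cas_apply]; ring
    simp only [e, integral_const_mul]
    rw [integral_sub (hib _) (hib _), ← pairing_apply, ← pairing_apply, h, h]; simp
  have hz : hc.toLp _ = 0 := by
    have hr : mFourierBasis.repr (hc.toLp _) = 0 := by
      ext n
      rw [mFourierBasis_repr]
      have hI : Integrable (fun x => mFourier (-n) x • ((u x j : ℝ) : ℂ)) torusMeasure := by
        simp only [smul_eq_mul]
        exact (hi.ofReal).bdd_mul (c := 1) (mFourier (-n)).continuous.aestronglyMeasurable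
          (ae_of_all _ fun x => (norm_mFourier_apply _ x).le)
      have : mFourierCoeff (hc.toLp _) n
          = ∫ x, mFourier (-n) x • ((u x j : ℝ) : ℂ) ∂torusMeasure :=
        integral_congr_ae (by filter_upwards [hc.coeFn_toLp] with x hx; rw [hx])
      rw [this]
      apply Complex.ext
      · have := integral_re (𝕜 := ℂ) hI
        simp only [RCLike.re_eq_complex_re] at this
        rw [← this]
        simpa [mul_comm] using hre (-n)
      · have := integral_im (𝕜 := ℂ) hI
        simp only [RCLike.im_eq_complex_im] at this
        rw [← this]
        simpa [mul_comm] using him (-n)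
    exact (LinearIsometryEquiv.map_eq_zero_iff _).1 hr
  have := hc.coeFn_toLp
  rw [hz] at this
  filter_upwards [this, Lp.coeFn_zero ℂ 2 torusMeasure] with x h1 h2
  rw [h2] at h1
  exact Complex.ofReal_eq_zero.1 h1.symm

lemma eq_zero_of_coef {u : L2} (h : ∀ j k, coef j k u = 0) : u = 0 := by
  rw [Lp.eq_zero_iff_ae_eq_zero]
  filter_upwards [coord_eq_zero_of_coef (h 0), coord_eq_zero_of_coef (h 1)] with x h0 h1
  ext j
  fin_cases j
  · exact h0
  · exact h1

lemma ext_coef {u v : L2} (h : ∀ j k, coef j k u = coef j k v) : u = v :=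
  sub_eq_zero.1 (eq_zero_of_coef fun j k => by rw [map_sub, h, sub_self])

/-- The Hartley basis of `L²(𝕋²; ℝ²)`. -/
def hartleyBasis : HilbertBasis (Fin 2 × Freq) ℝ L2 :=
  HilbertBasis.mkOfOrthogonalEqBot orthonormal_hartley <| by
    rw [Submodule.eq_bot_iff]
    intro u hu
    refine eq_zero_of_coef fun j k => ?_
    exact (Submodule.mem_orthogonal _ u).1 hu _ (Submodule.subset_span ⟨(j, k), rfl⟩)

lemma coe_hartleyBasis : ⇑hartleyBasis = hartley := HilbertBasis.coe_mkOfOrthogonalEqBot _ _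

lemma hasSum_hartley (u : L2) : HasSum (fun p => coef p.1 p.2 u • hartley p) u := by
  have := hartleyBasis.hasSum_repr u
  simp only [HilbertBasis.repr_apply_apply, coe_hartleyBasis] at this
  exact this

lemma hasSum_inner_coef (u v : L2) :
    HasSum (fun p : Fin 2 × Freq => coef p.1 p.2 u * coef p.1 p.2 v) (inner ℝ u v) := by
  have := hartleyBasis.hasSum_inner_mul_inner u v
  simp only [coe_hartleyBasis] at this
  refine this.congr_fun fun p => ?_
  rw [real_inner_comm (hartley p) u, inner_hartley, inner_hartley]

lemma hasSum_sq_coef (u : L2) :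
    HasSum (fun p : Fin 2 × Freq => coef p.1 p.2 u ^ 2) (‖u‖ ^ 2) := by
  simpa only [sq, real_inner_self_eq_norm_mul_norm] using hasSum_inner_coef u u

/-! ### Integration by parts on the torus -/

lemma IsSmooth.hasDerivAt_translate {ψ : Torus → ℝ} (h : IsSmooth ψ) (i : Fin 2) (p : Torus)
    (s : ℝ) : HasDerivAt (fun s : ℝ => ψ (p + Pi.single i (s : UnitAddCircle)))
      (CNS.pd i ψ (p + Pi.single i (s : UnitAddCircle))) s := by
  obtain ⟨x, rfl⟩ := cover_surjective p
  have he : ∀ s : ℝ, cover x + Pi.single i (s : UnitAddCircle)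
      = cover (x + s • Pi.single i (1 : ℝ)) := by
    intro s
    funext j
    by_cases hj : j = i
    · subst hj; simp [cover]
    · simp [cover, hj]
  simp only [he]
  rw [pd_cover h]
  have hd : HasFDerivAt (fun y => ψ (cover y)) (fderiv ℝ (fun y => ψ (cover y))
      (x + s • Pi.single i (1 : ℝ))) (x + s • Pi.single i (1 : ℝ)) :=
    ((ContDiff.differentiable h (by simp)).differentiableAt).hasFDerivAt
  have hl : HasDerivAt (fun s : ℝ => x + s • (Pi.single i (1 : ℝ) : Fin 2 → ℝ))
      (Pi.single i (1 : ℝ)) s := by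
    simpa using ((hasDerivAt_id s).smul_const (Pi.single i (1 : ℝ) : Fin 2 → ℝ)).const_add x
  exact hd.comp_hasDerivAt s hl

/-- Haar measure is translation invariant, so the integral of a translate of `ψ` is constant in the
shift; differentiate under the integral sign. -/
lemma integral_pd {ψ : Torus → ℝ} (h : IsSmooth ψ) (i : Fin 2) :
    ∫ x, pd i ψ x ∂torusMeasure = 0 := by
  obtain ⟨M, hM⟩ := (isCompact_univ (X := Torus)).exists_bound_of_continuousOn
    (h.pd i).continuous.continuousOn
  have hF : ∀ s : ℝ, Continuous fun p : Torus => ψ (p + Pi.single i (s : UnitAddCircle)) :=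
    fun s => h.continuous.comp (by fun_prop)
  have key := (hasDerivAt_integral_of_dominated_loc_of_deriv_le (μ := torusMeasure)
    (F := fun (s : ℝ) (p : Torus) => ψ (p + Pi.single i (s : UnitAddCircle)))
    (F' := fun (s : ℝ) (p : Torus) => pd i ψ (p + Pi.single i (s : UnitAddCircle)))
    (x₀ := 0) (bound := fun _ => M) (s := univ) Filter.univ_mem
    (Filter.Eventually.of_forall fun s => (hF s).aestronglyMeasurable)
    (integrable_of_continuous ⟨_, hF 0⟩)
    ((h.pd i).continuous.comp (by fun_prop)).aestronglyMeasurable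
    (ae_of_all _ fun p s _ => hM _ (mem_univ _)) (integrable_const _)
    (ae_of_all _ fun p s _ => h.hasDerivAt_translate i p s)).2
  have hconst : (fun s : ℝ => ∫ p, ψ (p + Pi.single i (s : UnitAddCircle)) ∂torusMeasure)
      = fun _ => ∫ p, ψ p ∂torusMeasure := by
    funext s
    exact integral_add_right_eq_self ψ _
  rw [hconst] at key
  have := key.unique (hasDerivAt_const _ _)
  simpa using this

lemma IsSmooth.mul {φ ψ : Torus → ℝ} (h : IsSmooth φ) (h' : IsSmooth ψ) :
    IsSmooth fun x => φ x * ψ x :=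
  ContDiff.mul h h'

lemma pd_mul {φ ψ : Torus → ℝ} (h : IsSmooth φ) (h' : IsSmooth ψ) (i : Fin 2) (x : Torus) :
    pd i (fun x => φ x * ψ x) x = pd i φ x * ψ x + φ x * pd i ψ x := by
  have h1 := (h.hasDerivAt_translate i x 0).fun_mul (h'.hasDerivAt_translate i x 0)
  have e : x + Pi.single i ((0 : ℝ) : UnitAddCircle) = x := by simp
  rw [e] at h1
  exact h1.deriv

lemma integral_mul_pd {φ ψ : Torus → ℝ} (h : IsSmooth φ) (h' : IsSmooth ψ) (i : Fin 2) :
    ∫ x, φ x * pd i ψ x ∂torusMeasure = - ∫ x, pd i φ x * ψ x ∂torusMeasure := by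
  have := integral_pd (h.mul h') i
  simp only [pd_mul h h'] at this
  have h1 : Integrable (fun x => pd i φ x * ψ x) torusMeasure :=
    integrable_of_continuous ⟨_, (h.pd i).continuous.mul h'.continuous⟩
  have h2 : Integrable (fun x => φ x * pd i ψ x) torusMeasure :=
    integrable_of_continuous ⟨_, h.continuous.mul (h'.pd i).continuous⟩
  rw [integral_add h1 h2] at this
  linarith

lemma pairing_hartley (i j : Fin 2) (k : Freq) (ψ : C(Torus, ℝ)) :
    pairing i ψ (hartley (j, k)) = if i = j then ∫ x, cas k x * ψ x ∂torusMeasure else 0 := by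
  rw [pairing_apply]
  have : ∀ᵐ x ∂torusMeasure, hartley (j, k) x i * ψ x
      = (if i = j then 1 else 0) * (cas k x * ψ x) := by
    filter_upwards [ContinuousMap.coeFn_toLp (E := Vec) (p := 2) (𝕜 := ℝ) torusMeasure
      (hartleyField (j, k))] with x hx
    unfold hartley
    rw [hx]
    simp only [hartleyField, ContinuousMap.coe_mk, PiLp.smul_apply, PiLp.single_apply,
      smul_eq_mul]
    ring
  rw [integral_congr_ae this, integral_const_mul]
  split_ifs <;> simp

lemma integral_cas_mul_pd (k : Freq) (i : Fin 2) {φ : Torus → ℝ} (h : IsSmooth φ) :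
    ∫ x, cas k x * pd i φ x ∂torusMeasure
      = - (2 * Real.pi * k i) * ∫ x, cas (-k) x * φ x ∂torusMeasure := by
  rw [integral_mul_pd (isSmooth_cas k) h, ← integral_const_mul, ← integral_neg]
  refine integral_congr_ae (ae_of_all _ fun x => ?_)
  simp only [pd_cas]
  ring

lemma hasWeakPartial_hartley (i j : Fin 2) (k : Freq) :
    HasWeakPartial i (hartley (j, k)) ((2 * Real.pi * k i) • hartley (j, -k)) := by
  rw [hasWeakPartial_iff]
  intro φ h l
  rw [map_smul, pairing_hartley, pairing_hartley]
  split_ifs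
  · simp only [ContinuousMap.coe_mk, integral_cas_mul_pd k i h, smul_eq_mul]
    ring
  · simp

/-! ### Hartley coefficients of derivatives -/

/-- Test the weak derivative against `cas_k`, whose partial derivative is a multiple of `cas_{-k}`;
this is the origin of the frequency flip. -/
lemma HasWeakPartial.coef_eq {i : Fin 2} {u g : L2} (h : HasWeakPartial i u g) (j : Fin 2)
    (k : Freq) : coef j k g = -(2 * Real.pi * k i) * coef j (-k) u := by
  have := h (cas k) (isSmooth_cas k) j
  rw [← pairing_apply] at this
  rw [eq_comm, neg_eq_iff_eq_neg] at this
  rw [this, pairing_apply, ← integral_const_mul, ← integral_neg]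
  refine integral_congr_ae (ae_of_all _ fun x => ?_)
  simp only [pd_cas]
  ring

lemma coef_grad (u : V) (i j : Fin 2) (k : Freq) :
    coef j k (V.grad u i) = -(2 * Real.pi * k i) * coef j (-k) (H.toL2 (V.toH u)) :=
  (V.weak u i).coef_eq j k

/-- Two derivatives flip the frequency twice, so the multiplier is diagonal. -/
lemma coef_hess (u : E) (i j l : Fin 2) (k : Freq) :
    coef l k (E.hess i j u) = -(4 * Real.pi ^ 2 * (k i * k j)) * coef l k (H.toL2 (E.toH u)) := by
  have h1 : coef l (-k) (E.grad u j) = _ := coef_grad (E.toV u) j l (-k)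
  rw [(E.weak u i j).coef_eq l k, h1, neg_neg]
  simp only [Pi.neg_apply, Int.cast_neg]
  change _ = _ * coef l k (H.toL2 (V.toH (E.toV u)))
  ring

/-- The eigenvalue `4π²|k|²` of the Stokes operator. -/
def lam (k : Freq) : ℝ := 4 * Real.pi ^ 2 * ((k 0 : ℝ) ^ 2 + (k 1 : ℝ) ^ 2)

lemma coef_A (u : E) (l : Fin 2) (k : Freq) :
    coef l k (H.toL2 (A u)) = lam k * coef l k (H.toL2 (E.toH u)) := by
  have : H.toL2 (A u) = -(E.hess 0 0 u + E.hess 1 1 u) := negLaplacian_apply u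
  rw [this, map_neg, map_add, coef_hess, coef_hess, lam]
  ring

lemma coef_zero_freq (u : H) (j : Fin 2) : coef j 0 (H.toL2 u) = 0 := by
  have h1 : cas 0 = 1 := by ext x; simp [cas_apply, mFourier_zero]
  have := (hasMeanZero_iff _).1 u.2.1 j
  rw [← h1] at this
  exact this

/-- The test function is `cas_{-k}`, because its gradient is proportional to `cas_k`. -/
lemma coef_divFree (u : H) (k : Freq) :
    k 0 * coef 0 k (H.toL2 u) + k 1 * coef 1 k (H.toL2 u) = 0 := by
  have h := H.isDivFree u (cas (-k)) (isSmooth_cas _)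
  simp only [pd_cas, neg_neg, Fin.sum_univ_two, Pi.neg_apply, Int.cast_neg] at h
  have e : ∀ j : Fin 2, ∫ x, H.toL2 u x j * (2 * Real.pi * -(k j : ℝ) * cas k x) ∂torusMeasure
      = -(2 * Real.pi) * (k j * coef j k (H.toL2 u)) := by
    intro j
    rw [pairing_apply, ← mul_assoc, ← integral_const_mul]
    refine integral_congr_ae (ae_of_all _ fun x => ?_)
    simp only
    ring
  rw [e, e, ← mul_add] at h
  exact (mul_eq_zero.1 h).resolve_left (by simp [Real.pi_ne_zero])

lemma lam_nonneg (k : Freq) : 0 ≤ lam k := by unfold lam; positivity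

lemma one_le_sq_add_sq {k : Freq} (hk : k ≠ 0) : (1 : ℝ) ≤ (k 0 : ℝ) ^ 2 + (k 1 : ℝ) ^ 2 := by
  have : (1 : ℤ) ≤ k 0 ^ 2 + k 1 ^ 2 := by
    by_contra hlt
    have h0 : k 0 = 0 := by nlinarith [sq_nonneg (k 0), sq_nonneg (k 1)]
    have h1 : k 1 = 0 := by nlinarith [sq_nonneg (k 0), sq_nonneg (k 1)]
    exact hk (by ext i; fin_cases i <;> simp [h0, h1])
  exact_mod_cast this

lemma sq_add_sq_le_lam (k : Freq) : (k 0 : ℝ) ^ 2 + (k 1 : ℝ) ^ 2 ≤ lam k := by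
  unfold lam
  have : 1 ≤ 4 * Real.pi ^ 2 := by nlinarith [Real.pi_gt_three]
  nlinarith [sq_nonneg (k 0 : ℝ), sq_nonneg (k 1 : ℝ)]

lemma one_le_lam {k : Freq} (hk : k ≠ 0) : 1 ≤ lam k :=
  (one_le_sq_add_sq hk).trans (sq_add_sq_le_lam k)

/-! ### Norms -/

lemma H.norm_toL2 (u : H) : ‖H.toL2 u‖ = ‖u‖ := rfl

lemma H.inner_toL2 (u v : H) : inner ℝ (H.toL2 u) (H.toL2 v) = inner ℝ u v := rfl

lemma H.toL2_injective : Function.Injective H.toL2 := Subtype.val_injective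

lemma V.norm_sq (u : V) : ‖u‖ ^ 2 = ‖V.toH u‖ ^ 2 + ‖V.grad u‖ ^ 2 :=
  WithLp.prod_norm_sq_eq_of_L2 _

lemma E.norm_sq (u : E) : ‖u‖ ^ 2 = ‖E.toV u‖ ^ 2 + ∑ p : Fin 2 × Fin 2, ‖E.hess p.1 p.2 u‖ ^ 2 := by
  have h1 : ‖u‖ ^ 2 = ‖E.toV u‖ ^ 2 + ‖(WithLp.sndL 2 ℝ V Hessians) (graphE.subtypeL u)‖ ^ 2 :=
    WithLp.prod_norm_sq_eq_of_L2 _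
  rw [h1, PiLp.norm_sq_eq_of_L2]
  rfl

/-- An element of `V` carries its weak derivatives as data; their coefficients are determined by
those of the field, so nothing is lost by forgetting them. -/
lemma V.toH_injective : Function.Injective V.toH := by
  rw [injective_iff_map_eq_zero]
  intro u hu
  have hg : V.grad u = 0 := by
    ext i : 1
    refine eq_zero_of_coef fun j k => ?_
    rw [coef_grad, hu, map_zero, map_zero, mul_zero]
  have := V.norm_sq u
  rw [hu, hg] at this
  simpa using this

lemma E.toH_injective : Function.Injective E.toH := by
  rw [injective_iff_map_eq_zero]
  intro u hu
  have h1 : E.toV u = 0 := V.toH_injective (by rw [map_zero]; exact hu)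
  have h2 : ∀ i j, E.hess i j u = 0 := fun i j =>
    eq_zero_of_coef fun l k => by rw [coef_hess, hu, map_zero, map_zero, mul_zero]
  have := E.norm_sq u
  simp only [h1, h2] at this
  simpa using this

lemma hasSum_neg_freq {f : Fin 2 × Freq → ℝ} {a : ℝ} (h : HasSum f a) :
    HasSum (fun p : Fin 2 × Freq => f (p.1, -p.2)) a :=
  ((Equiv.refl (Fin 2)).prodCongr (Equiv.neg Freq)).hasSum_iff.2 h

lemma hasSum_sq_grad (u : V) :
    HasSum (fun p : Fin 2 × Freq => lam p.2 * coef p.1 p.2 (H.toL2 (V.toH u)) ^ 2)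
      (‖V.grad u‖ ^ 2) := by
  rw [PiLp.norm_sq_eq_of_L2]
  have h := hasSum_sum (s := Finset.univ) fun i (_ : i ∈ (Finset.univ : Finset (Fin 2))) =>
    hasSum_neg_freq (hasSum_sq_coef (V.grad u i))
  refine h.congr_fun fun p => ?_
  simp only [coef_grad, neg_neg, Fin.sum_univ_two, lam, Pi.neg_apply, Int.cast_neg]
  ring

lemma norm_grad_sq (u : E) : ‖E.grad u‖ ^ 2 = inner ℝ (A u) (E.toH u) := by
  refine (hasSum_sq_grad (E.toV u)).unique ?_
  rw [← H.inner_toL2]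
  refine (hasSum_inner_coef _ _).congr_fun fun p => ?_
  rw [coef_A]
  change _ * coef p.1 p.2 (H.toL2 (E.toH u)) ^ 2 = _
  ring

/-- By Parseval. This reduces the operator inequalities below to inequalities between multipliers.
-/
lemma norm_le_of_coef {u v : L2} (h : ∀ j k, |coef j k u| ≤ |coef j k v|) : ‖u‖ ≤ ‖v‖ := by
  refine le_of_sq_le_sq (hasSum_le (fun p => ?_) (hasSum_sq_coef u) (hasSum_sq_coef v)) (norm_nonneg _)
  exact sq_le_sq.2 (h p.1 p.2)

/-- `(A + μ) u`. -/
def shiftedA (μ : ℝ) : E →L[ℝ] H := A + μ • E.toH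

lemma shiftedA_apply (μ : ℝ) (u : E) : shiftedA μ u = A u + μ • E.toH u := rfl

lemma coef_shiftedA (μ : ℝ) (u : E) (l : Fin 2) (k : Freq) :
    coef l k (H.toL2 (shiftedA μ u)) = (lam k + μ) * coef l k (H.toL2 (E.toH u)) := by
  rw [shiftedA_apply, map_add, map_smul, map_add, map_smul, coef_A, smul_eq_mul]
  ring

lemma norm_A_le {μ : ℝ} (hμ : 0 ≤ μ) (u : E) : ‖A u‖ ≤ ‖shiftedA μ u‖ := by
  rw [← H.norm_toL2, ← H.norm_toL2]
  refine norm_le_of_coef fun j k => ?_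
  rw [coef_A, coef_shiftedA, abs_mul, abs_mul]
  have := lam_nonneg k
  gcongr
  linarith

lemma mul_norm_toH_le {μ : ℝ} (hμ : 0 ≤ μ) (u : E) : μ * ‖E.toH u‖ ≤ ‖shiftedA μ u‖ := by
  rw [← H.norm_toL2, ← H.norm_toL2 (shiftedA μ u)]
  have : μ * ‖H.toL2 (E.toH u)‖ = ‖μ • H.toL2 (E.toH u)‖ := by
    rw [norm_smul, Real.norm_of_nonneg hμ]
  rw [this]
  refine norm_le_of_coef fun j k => ?_
  rw [map_smul, coef_shiftedA, smul_eq_mul, abs_mul, abs_mul]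
  have := lam_nonneg k
  gcongr
  linarith

/-- Poincaré inequality: mean zero removes `k = 0`, and every other eigenvalue is at least one. -/
lemma norm_toH_le_norm_A (u : E) : ‖E.toH u‖ ≤ ‖A u‖ := by
  rw [← H.norm_toL2, ← H.norm_toL2]
  refine norm_le_of_coef fun j k => ?_
  by_cases hk : k = 0
  · subst hk
    rw [coef_zero_freq, coef_zero_freq]
  rw [coef_A, abs_mul]
  refine le_mul_of_one_le_left (abs_nonneg _) ?_
  rw [abs_of_nonneg (lam_nonneg k)]
  exact one_le_lam hk

lemma norm_hess_le_norm_A (u : E) (i j : Fin 2) : ‖E.hess i j u‖ ≤ ‖A u‖ := by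
  rw [← H.norm_toL2]
  refine norm_le_of_coef fun l k => ?_
  rw [coef_A, coef_hess, abs_mul, abs_mul]
  refine mul_le_mul_of_nonneg_right ?_ (abs_nonneg _)
  rw [abs_of_nonneg (lam_nonneg k), lam, abs_neg, abs_mul, abs_of_nonneg (by positivity)]
  gcongr
  rw [abs_le]
  fin_cases i <;> fin_cases j <;> constructor <;> simp <;>
    nlinarith [sq_nonneg ((k 0 : ℝ) + k 1), sq_nonneg ((k 0 : ℝ) - k 1), sq_nonneg (k 0 : ℝ),
      sq_nonneg (k 1 : ℝ)]

/-- Interpolation: `|∇u|² = ⟨Au, u⟩`, where `|Au|` and `μ|u|` are each at most `|(A + μ)u|`. -/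
lemma mul_norm_grad_sq_le {μ : ℝ} (hμ : 0 ≤ μ) (u : E) :
    μ * ‖E.grad u‖ ^ 2 ≤ ‖shiftedA μ u‖ ^ 2 := by
  have h1 : ‖E.grad u‖ ^ 2 ≤ ‖A u‖ * ‖E.toH u‖ := by
    rw [norm_grad_sq]; exact real_inner_le_norm _ _
  calc μ * ‖E.grad u‖ ^ 2 ≤ μ * (‖A u‖ * ‖E.toH u‖) := by gcongr
    _ = ‖A u‖ * (μ * ‖E.toH u‖) := by ring
    _ ≤ ‖shiftedA μ u‖ * ‖shiftedA μ u‖ :=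
        mul_le_mul (norm_A_le hμ u) (mul_norm_toH_le hμ u) (by positivity) (norm_nonneg _)
    _ = _ := by ring

lemma norm_toV_sq_le (u : E) : ‖E.toV u‖ ^ 2 ≤ ‖E.toH u‖ ^ 2 + inner ℝ (A u) (E.toH u) := by
  rw [V.norm_sq, ← norm_grad_sq]; exact le_rfl

lemma norm_le_norm_A (u : E) : ‖u‖ ≤ 3 * ‖A u‖ := by
  have h1 : inner ℝ (A u) (E.toH u) ≤ ‖A u‖ * ‖E.toH u‖ := real_inner_le_norm _ _
  have h2 := norm_toV_sq_le u
  have h3 := norm_toH_le_norm_A u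
  have h4 : ∑ p : Fin 2 × Fin 2, ‖E.hess p.1 p.2 u‖ ^ 2 ≤ ∑ p : Fin 2 × Fin 2, ‖A u‖ ^ 2 :=
    Finset.sum_le_sum fun p _ => by gcongr; exact norm_hess_le_norm_A u _ _
  simp only [Finset.sum_const, Finset.card_univ, Fintype.card_prod, Fintype.card_fin,
    nsmul_eq_mul] at h4
  have h5 := E.norm_sq u
  refine le_of_sq_le_sq ?_ (by positivity)
  have h6 : ‖A u‖ * ‖E.toH u‖ ≤ ‖A u‖ * ‖A u‖ := by gcongr
  have h7 : ‖E.toH u‖ ^ 2 ≤ ‖A u‖ ^ 2 := by gcongr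
  push_cast at h4
  -- The squared `H²` norm is at most `(1 + 1 + 4)|Au|²`: the field, its gradient and four second
  -- derivatives. The factor 3 has square 9.
  nlinarith

/-! ### Completeness -/

/-- Being a weak derivative is a family of equations between continuous linear functionals, so the
graph is closed in a complete space. The same applies to `E`. -/
instance : CompleteSpace V := by
  have hc : IsClosed (graphV : Set (WithLp 2 (H × Grads))) := by
    have : (graphV : Set (WithLp 2 (H × Grads))) = {w | ∀ (i : Fin 2) (φ : Torus → ℝ)
        (h : IsSmooth φ) (j : Fin 2), pairing j ⟨_, (h.pd i).continuous⟩ (H.toL2 w.fst)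
          + pairing j ⟨φ, h.continuous⟩ (w.snd i) = 0} := by
      ext w
      exact forall_congr' fun i => hasWeakPartial_iff _ _ _
    rw [this]
    simp only [ofPred_forall]
    refine isClosed_iInter fun i => isClosed_iInter fun φ => isClosed_iInter fun h =>
      isClosed_iInter fun j => isClosed_eq ?_ continuous_const
    exact ((pairing j ⟨_, (h.pd i).continuous⟩).comp
        (H.toL2.comp (WithLp.fstL 2 ℝ H Grads))).continuous.add
      ((pairing j ⟨φ, h.continuous⟩).comp ((PiLp.proj 2 (fun _ : Fin 2 => L2) i).comp
        (WithLp.sndL 2 ℝ H Grads))).continuous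
  exact hc.completeSpace_coe

instance : CompleteSpace E := by
  have hc : IsClosed (graphE : Set (WithLp 2 (V × Hessians))) := by
    have : (graphE : Set (WithLp 2 (V × Hessians))) = {w | ∀ (i l : Fin 2) (φ : Torus → ℝ)
        (h : IsSmooth φ) (j : Fin 2), pairing j ⟨_, (h.pd i).continuous⟩ (V.grad w.fst l)
          + pairing j ⟨φ, h.continuous⟩ (w.snd (i, l)) = 0} := by
      ext w
      exact forall_congr' fun i => forall_congr' fun l => hasWeakPartial_iff _ _ _
    rw [this]
    simp only [ofPred_forall]
    refine isClosed_iInter fun i => isClosed_iInter fun l => isClosed_iInter fun φ =>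
      isClosed_iInter fun h => isClosed_iInter fun j => isClosed_eq ?_ continuous_const
    exact ((pairing j ⟨_, (h.pd i).continuous⟩).comp ((PiLp.proj 2 (fun _ : Fin 2 => L2) l).comp
        (V.grad.comp (WithLp.fstL 2 ℝ V Hessians)))).continuous.add
      ((pairing j ⟨φ, h.continuous⟩).comp ((PiLp.proj 2 (fun _ : Fin 2 × Fin 2 => L2) (i, l)).comp
        (WithLp.sndL 2 ℝ V Hessians))).continuous
  exact hc.completeSpace_coe

/-! ### Eigenfunctions of the Stokes operator -/

/-- Nonzero frequencies. -/
abbrev NZFreq : Type := {k : Freq // k ≠ 0}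

/-- The unit vector `k^⊥ / |k|`. -/
def perp (k : Freq) (j : Fin 2) : ℝ :=
  ![-(k 1 : ℝ), k 0] j / Real.sqrt ((k 0 : ℝ) ^ 2 + (k 1 : ℝ) ^ 2)

lemma mul_perp (k : Freq) : k 0 * perp k 0 + k 1 * perp k 1 = 0 := by
  simp only [perp, Matrix.cons_val_zero, Matrix.cons_val_one]
  ring

lemma perp_sq {k : Freq} (hk : k ≠ 0) : perp k 0 ^ 2 + perp k 1 ^ 2 = 1 := by
  have h := one_le_sq_add_sq hk
  simp only [perp, Matrix.cons_val_zero, Matrix.cons_val_one, div_pow,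
    Real.sq_sqrt (zero_le_one.trans h)]
  field_simp
  ring

/-- The vector field `cas_l d` for a constant vector `d`. -/
def plane (d : Fin 2 → ℝ) (l : Freq) : L2 := d 0 • hartley (0, l) + d 1 • hartley (1, l)

lemma hasWeakPartial_plane (d : Fin 2 → ℝ) (l : Freq) (i : Fin 2) :
    HasWeakPartial i (plane d l) ((2 * Real.pi * l i) • plane d (-l)) := by
  have := ((hasWeakPartial_hartley i 0 l).smul (d 0)).add ((hasWeakPartial_hartley i 1 l).smul (d 1))
  simpa only [plane, smul_add, smul_comm (2 * Real.pi * (l i : ℝ))] using this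

lemma coef_plane (d : Fin 2 → ℝ) (k l : Freq) (j : Fin 2) :
    coef j k (plane d l) = if k = l then d j else 0 := by
  rw [plane, map_add, map_smul, map_smul, coef_hartley, coef_hartley]
  fin_cases j <;> simp

/-- The mean vanishes since `k ≠ 0`, the divergence since `k · k^⊥ = 0`. -/
lemma plane_perp_mem (k : NZFreq) : plane (perp k) k ∈ solenoidal := by
  constructor
  · rw [hasMeanZero_iff]
    intro j
    have h1 : cas 0 = 1 := by ext x; simp [cas_apply, mFourier_zero]
    rw [← h1]
    change coef j 0 _ = 0
    rw [coef_plane, if_neg (Ne.symm k.2)]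
  · rw [isDivFree_iff]
    intro φ h
    simp only [Fin.sum_univ_two, plane, map_add, map_smul, pairing_hartley,
      ContinuousMap.coe_mk, integral_cas_mul_pd _ _ h]
    simp only [if_true, one_ne_zero, zero_ne_one, if_false, smul_eq_mul]
    linear_combination
      (-(2 * Real.pi) * ∫ x, cas (-k.1) x * φ x ∂torusMeasure) * mul_perp k.1

/-- The normalized eigenfunction of the Stokes operator of frequency `k`, in `H`. -/
def eigenH (k : NZFreq) : H := ⟨plane (perp k) k, plane_perp_mem k⟩

/-- The normalized eigenfunction of the Stokes operator of frequency `k`, in `V`. -/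
def eigenV (k : NZFreq) : V :=
  ⟨WithLp.toLp 2 (eigenH k, WithLp.toLp 2 fun i => (2 * Real.pi * k.1 i) • plane (perp k) (-k)),
    fun i => hasWeakPartial_plane _ _ i⟩

/-- The normalized eigenfunction of the Stokes operator of frequency `k`, in `E`. -/
def eigenE (k : NZFreq) : E :=
  ⟨WithLp.toLp 2 (eigenV k, WithLp.toLp 2 fun p =>
    (2 * Real.pi * k.1 p.2) • (2 * Real.pi * (-k.1) p.1) • plane (perp k) k), fun i j => by
      have := (hasWeakPartial_plane (perp k) (-k) i).smul (2 * Real.pi * k.1 j)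
      rw [neg_neg] at this
      exact this⟩

lemma toL2_eigenH (k : NZFreq) : H.toL2 (eigenH k) = plane (perp k) k := rfl

lemma toH_eigenE (k : NZFreq) : E.toH (eigenE k) = eigenH k := rfl

lemma A_eigenE (k : NZFreq) : A (eigenE k) = lam k • eigenH k := by
  refine H.toL2_injective (ext_coef fun j l => ?_)
  rw [coef_A, map_smul, map_smul, toH_eigenE, toL2_eigenH, coef_plane, smul_eq_mul]
  split_ifs with h
  · rw [h]
  · simp

lemma inner_eigenH (k : NZFreq) (u : H) : inner ℝ (eigenH k) u
    = perp k 0 * coef 0 k (H.toL2 u) + perp k 1 * coef 1 k (H.toL2 u) := by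
  rw [← H.inner_toL2, toL2_eigenH, plane, inner_add_left, real_inner_smul_left,
    real_inner_smul_left, inner_hartley, inner_hartley]

/-- In two dimensions a coefficient vector orthogonal to `k` is a multiple of `k^⊥`, so its
component along `k^⊥` has its full length. Completeness of the eigenfunctions follows. -/
lemma inner_eigenH_sq (k : NZFreq) (u : H) : inner ℝ (eigenH k) u ^ 2
    = coef 0 k (H.toL2 u) ^ 2 + coef 1 k (H.toL2 u) ^ 2 := by
  have h1 := coef_divFree u k
  have h2 := one_le_sq_add_sq k.2
  rw [inner_eigenH]
  simp only [perp, Matrix.cons_val_zero, Matrix.cons_val_one]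
  set a := (k.1 0 : ℝ)
  set b := (k.1 1 : ℝ)
  set x := coef 0 k (H.toL2 u)
  set y := coef 1 k (H.toL2 u)
  have e : -b / Real.sqrt (a ^ 2 + b ^ 2) * x + a / Real.sqrt (a ^ 2 + b ^ 2) * y
    = (a * y - b * x) / Real.sqrt (a ^ 2 + b ^ 2) := by ring
  rw [e, div_pow, Real.sq_sqrt (zero_le_one.trans h2), div_eq_iff (by positivity)]
  -- Lagrange's identity: `(ay - bx)² + (ax + by)² = (a² + b²)(x² + y²)`.
  linear_combination (-(a * x + b * y)) * h1

lemma orthonormal_eigenH : Orthonormal ℝ eigenH := by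
  rw [orthonormal_iff_ite]
  intro k l
  rw [inner_eigenH, toL2_eigenH, coef_plane, coef_plane]
  by_cases h : k = l
  · subst h
    simp only [if_true]
    linarith [perp_sq k.2]
  · have : (k : Freq) ≠ l := fun h' => h (Subtype.ext h')
    simp [h, this]

/-- The Hilbert basis of `H` of eigenfunctions of the Stokes operator. -/
def stokesBasis : HilbertBasis NZFreq ℝ H :=
  HilbertBasis.mkOfOrthogonalEqBot orthonormal_eigenH <| by
    rw [Submodule.eq_bot_iff]
    intro u hu
    have h0 : ∀ k : NZFreq, inner ℝ (eigenH k) u = 0 := fun k =>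
      (Submodule.mem_orthogonal _ u).1 hu _ (Submodule.subset_span ⟨k, rfl⟩)
    refine H.toL2_injective (ext_coef fun j k => ?_)
    rw [map_zero, map_zero]
    by_cases hk : k = 0
    · rw [hk, coef_zero_freq]
    · have h1 := inner_eigenH_sq ⟨k, hk⟩ u
      rw [h0] at h1
      simp only at h1
      have h2 : coef 0 k (H.toL2 u) = 0 := by
        nlinarith [sq_nonneg (coef 0 k (H.toL2 u)), sq_nonneg (coef 1 k (H.toL2 u))]
      have h3 : coef 1 k (H.toL2 u) = 0 := by
        nlinarith [sq_nonneg (coef 0 k (H.toL2 u)), sq_nonneg (coef 1 k (H.toL2 u))]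
      fin_cases j
      · exact h2
      · exact h3

lemma coe_stokesBasis : ⇑stokesBasis = eigenH := HilbertBasis.coe_mkOfOrthogonalEqBot _ _

lemma hasSum_sq_inner_eigenH (u : H) :
    HasSum (fun k => inner ℝ (eigenH k) u ^ 2) (‖u‖ ^ 2) := by
  have := stokesBasis.hasSum_inner_mul_inner u u
  simp only [coe_stokesBasis, real_inner_self_eq_norm_sq] at this
  refine this.congr_fun fun k => ?_
  rw [real_inner_comm (eigenH k) u, sq]

lemma ext_inner_eigenH {u v : H} (h : ∀ k, inner ℝ (eigenH k) u = inner ℝ (eigenH k) v) :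
    u = v := by
  refine stokesBasis.repr.injective (lp.ext (funext fun k => ?_))
  simp only [HilbertBasis.repr_apply_apply, coe_stokesBasis, h]

lemma inner_eigenH_A (k : NZFreq) (u : E) :
    inner ℝ (eigenH k) (A u) = lam k * inner ℝ (eigenH k) (E.toH u) := by
  rw [inner_eigenH, inner_eigenH, coef_A, coef_A]
  ring

lemma inner_eigenH_shiftedA (μ : ℝ) (k : NZFreq) (u : E) :
    inner ℝ (eigenH k) (shiftedA μ u) = (lam k + μ) * inner ℝ (eigenH k) (E.toH u) := by
  rw [shiftedA_apply, inner_add_right, inner_smul_right, inner_eigenH_A]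
  ring

/-- This is how the regularity `ω₀ ∈ V` enters the construction of solutions. -/
lemma summable_lam_mul_sq (u : V) :
    Summable fun k : NZFreq => lam k * inner ℝ (eigenH k) (V.toH u) ^ 2 := by
  have h := (hasSum_sq_grad u).summable
  have h' : ∀ j : Fin 2, Summable fun k : NZFreq =>
      lam k * coef j k (H.toL2 (V.toH u)) ^ 2 := fun j =>
    h.comp_injective (i := fun k : NZFreq => ((j, (k : Freq)) : Fin 2 × Freq)) fun a b hab =>
      Subtype.ext (congrArg Prod.snd hab)
  refine ((h' 0).add (h' 1)).congr fun k => ?_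
  rw [inner_eigenH_sq]
  ring

/-! ### The embedding of `E` into bounded fields -/

lemma norm_le_sqrt_lam (k : Freq) : ‖k‖ ^ 2 ≤ lam k := by
  refine le_trans ?_ (sq_add_sq_le_lam k)
  have h : ‖k‖ ≤ Real.sqrt ((k 0 : ℝ) ^ 2 + (k 1 : ℝ) ^ 2) := by
    rw [pi_norm_le_iff_of_nonneg (Real.sqrt_nonneg _)]
    intro i
    rw [Int.norm_eq_abs]
    apply Real.abs_le_sqrt
    fin_cases i
    · simpa using sq_nonneg (k 1 : ℝ)
    · simpa using sq_nonneg (k 0 : ℝ)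
  calc ‖k‖ ^ 2 ≤ Real.sqrt ((k 0 : ℝ) ^ 2 + (k 1 : ℝ) ^ 2) ^ 2 := by gcongr
    _ = _ := Real.sq_sqrt (by positivity)

/-- The exponent 3 exceeds the lattice dimension 2. The zero frequency contributes 0, as the inverse
of zero is zero. -/
lemma summable_norm_freq : Summable fun p : Fin 2 × Freq => (‖p.2‖ ^ 3)⁻¹ := by
  have h := EisensteinSeries.summable_one_div_norm_rpow (k := 3) (by norm_num)
  have h' : Summable fun k : Freq => (‖k‖ ^ 3)⁻¹ := by
    refine h.congr fun k => ?_
    rw [Real.rpow_neg (norm_nonneg k)]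
    norm_cast
  have := (Summable.of_finite (f := fun _ : Fin 2 => (1 : ℝ))).mul_of_nonneg h'
    (fun _ => zero_le_one) (fun _ => by positivity)
  simpa using this

/-- The sum `∑ |k|⁻³` over two copies of the nonzero frequencies. -/
def latticeSum : ℝ := ∑' p : Fin 2 × Freq, (‖p.2‖ ^ 3)⁻¹

lemma latticeSum_nonneg : 0 ≤ latticeSum := tsum_nonneg fun _ => by positivity

/-- The multiplier inequality is `m|k|³ ≤ (|k|² + m²)²`: of the four available powers, three go to
summability in `k` and one is kept for smallness in `m`. -/
lemma abs_coef_le {m : ℝ} (hm : 0 < m) (u : E) (p : Fin 2 × Freq) :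
    |coef p.1 p.2 (H.toL2 (E.toH u))|
      ≤ Real.sqrt ((‖p.2‖ ^ 3)⁻¹ / m) * |coef p.1 p.2 (H.toL2 (shiftedA (m ^ 2) u))| := by
  obtain ⟨j, k⟩ := p
  simp only
  by_cases hk : k = 0
  · subst hk
    rw [coef_zero_freq]
    simp
  have hn : 0 < ‖k‖ := norm_pos_iff.2 hk
  have h1 := norm_le_sqrt_lam k
  have hpos : 0 < lam k + m ^ 2 := by positivity [lam_nonneg k]
  rw [coef_shiftedA, abs_mul, ← mul_assoc, abs_of_pos hpos]
  refine le_mul_of_one_le_left (abs_nonneg _) ?_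
  rw [← div_le_iff₀ hpos]
  apply Real.le_sqrt_of_sq_le
  rw [div_pow, one_pow, ← one_div, div_div]
  refine one_div_le_one_div_of_le (by positivity) ?_
  have h2 : (‖k‖ ^ 2 + m ^ 2) ^ 2 ≤ (lam k + m ^ 2) ^ 2 := by gcongr
  refine le_trans ?_ h2
  nlinarith [sq_nonneg (‖k‖ - m), sq_nonneg (‖k‖ * m), mul_pos hn hm, sq_nonneg (m ^ 2),
    mul_nonneg (sq_nonneg ‖k‖) (sq_nonneg (‖k‖ - m))]

/-- Cauchy–Schwarz between the weights of `abs_coef_le` and the coefficients of `(A + m²)u`. -/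
lemma summable_abs_coef {m : ℝ} (hm : 0 < m) (u : E) :
    Summable (fun p : Fin 2 × Freq => |coef p.1 p.2 (H.toL2 (E.toH u))|) ∧
    ∑' p : Fin 2 × Freq, |coef p.1 p.2 (H.toL2 (E.toH u))|
      ≤ Real.sqrt (latticeSum / m) * ‖shiftedA (m ^ 2) u‖ := by
  have hs : HasSum (fun p : Fin 2 × Freq => Real.sqrt ((‖p.2‖ ^ 3)⁻¹ / m) ^ (2 : ℝ))
      (Real.sqrt (latticeSum / m) ^ (2 : ℝ)) := by
    have h : ∀ x : ℝ, 0 ≤ x → Real.sqrt (x / m) ^ (2 : ℝ) = x / m := fun x hx => by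
      rw [Real.rpow_two, Real.sq_sqrt (by positivity)]
    rw [h _ latticeSum_nonneg]
    refine (summable_norm_freq.hasSum.div_const m).congr_fun fun p => ?_
    rw [h _ (by positivity)]
  have ht : HasSum (fun p : Fin 2 × Freq => |coef p.1 p.2 (H.toL2 (shiftedA (m ^ 2) u))| ^ (2 : ℝ))
      (‖shiftedA (m ^ 2) u‖ ^ (2 : ℝ)) := by
    simp only [Real.rpow_two, sq_abs, ← H.norm_toL2]
    exact hasSum_sq_coef _
  obtain ⟨c, -, hc, hsum⟩ := Real.inner_le_Lp_mul_Lq_hasSum_of_nonneg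
    (Real.HolderConjugate.two_two) (Real.sqrt_nonneg _) (norm_nonneg _)
    (fun p => Real.sqrt_nonneg _) (fun p => abs_nonneg _) hs ht
  have hS : Summable (fun p : Fin 2 × Freq => |coef p.1 p.2 (H.toL2 (E.toH u))|) :=
    Summable.of_nonneg_of_le (fun _ => abs_nonneg _) (abs_coef_le hm u) hsum.summable
  exact ⟨hS, (hasSum_le (abs_coef_le hm u) hS.hasSum hsum).trans hc⟩

lemma norm_hartleyField_le (p : Fin 2 × Freq) : ‖hartleyField p‖ ≤ 2 := by
  rw [ContinuousMap.norm_le _ zero_le_two]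
  intro x
  simp only [hartleyField, ContinuousMap.coe_mk, norm_smul, PiLp.norm_single, norm_one, mul_one]
  exact abs_cas_le _ x

/-- Elements of `E` are bounded, with a bound that is small relative to `A + m²` for large `m`. -/
lemma ae_norm_le {m : ℝ} (hm : 0 < m) (u : E) : ∀ᵐ x ∂torusMeasure,
    ‖H.toL2 (E.toH u) x‖ ≤ 2 * Real.sqrt (latticeSum / m) * ‖shiftedA (m ^ 2) u‖ := by
  obtain ⟨hS, hle⟩ := summable_abs_coef hm u
  have hb : ∀ p : Fin 2 × Freq, ‖coef p.1 p.2 (H.toL2 (E.toH u)) • hartleyField p‖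
      ≤ 2 * |coef p.1 p.2 (H.toL2 (E.toH u))| := fun p => by
    rw [norm_smul, Real.norm_eq_abs, mul_comm]
    gcongr
    exact norm_hartleyField_le p
  have hF := Summable.of_norm_bounded (hS.mul_left 2) hb
  have hn : ‖∑' p : Fin 2 × Freq, coef p.1 p.2 (H.toL2 (E.toH u)) • hartleyField p‖
      ≤ 2 * Real.sqrt (latticeSum / m) * ‖shiftedA (m ^ 2) u‖ := by
    refine (tsum_of_norm_bounded (hS.mul_left 2).hasSum hb).trans ?_
    rw [tsum_mul_left, mul_assoc]
    gcongr
  -- The Hartley series converges uniformly to a continuous field; by uniqueness of sums in `L²`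
  -- that field represents `u`, so its sup norm bounds `u` almost everywhere.
  have hL := hF.hasSum.mapL (ContinuousMap.toLp (E := Vec) 2 torusMeasure ℝ)
  simp only [map_smul] at hL
  rw [(hasSum_hartley (H.toL2 (E.toH u))).unique hL]
  filter_upwards [ContinuousMap.coeFn_toLp (E := Vec) (p := 2) (𝕜 := ℝ) torusMeasure
    (∑' p : Fin 2 × Freq, coef p.1 p.2 (H.toL2 (E.toH u)) • hartleyField p)] with x hx
  rw [hx]
  exact (ContinuousMap.norm_coe_le_norm _ x).trans hn

/-! ### The bilinear map `B` -/

lemma norm_grad_apply_le (v : V) (i : Fin 2) : ‖V.grad v i‖ ≤ ‖V.grad v‖ :=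
  PiLp.norm_apply_le (V.grad v) i

lemma memLp_convection_term {M : ℝ} {u : E}
    (hu : ∀ᵐ x ∂torusMeasure, ‖H.toL2 (E.toH u) x‖ ≤ M) (g : L2) (i : Fin 2) :
    MemLp (fun x => H.toL2 (E.toH u) x i • g x) 2 torusMeasure := by
  refine (Lp.memLp g).of_le_mul (c := M)
    ((memLp_coord _ i).aestronglyMeasurable.smul (Lp.memLp g).aestronglyMeasurable) ?_
  filter_upwards [hu] with x hx
  rw [norm_smul]
  gcongr
  exact (PiLp.norm_apply_le _ i).trans hx

lemma memLp_convection (u v : E) : MemLp (convection (E.toV u) (E.toV v)) 2 torusMeasure := by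
  have hu := ae_norm_le one_pos u
  have h := (memLp_convection_term hu (V.grad (E.toV v) 0) 0).add
    (memLp_convection_term hu (V.grad (E.toV v) 1) 1)
  refine (memLp_congr_ae (ae_of_all _ fun x => ?_)).1 h
  simp only [convection, Fin.sum_univ_two]
  rfl

/-- On `E` the default value 0 of `leray` is never taken, so `B` is genuinely bilinear there. -/
lemma B_eq (u v : E) : B (E.toV u) v = H.proj ((memLp_convection u v).toLp _) := by
  unfold B leray
  rw [dif_pos (memLp_convection u v)]

lemma norm_proj_le (f : L2) : ‖H.proj f‖ ≤ ‖f‖ := by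
  have := solenoidal.orthogonalProjectionOnto.le_opNorm f
  refine this.trans ?_
  exact mul_le_of_le_one_left (norm_nonneg _) (Submodule.orthogonalProjectionOnto_norm_le _)

/-- The sup bound `M` is a parameter because it is used both with the fixed embedding constant and
with the bound that is small for large `m`. The 2 counts the terms of the convection sum. -/
lemma norm_B_le {M : ℝ} (hM : 0 ≤ M) {u : E}
    (hu : ∀ᵐ x ∂torusMeasure, ‖H.toL2 (E.toH u) x‖ ≤ M) (v : E) :
    ‖B (E.toV u) v‖ ≤ 2 * M * ‖E.grad v‖ := by
  rw [B_eq]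
  refine (norm_proj_le _).trans ?_
  have hterm : ∀ i : Fin 2, ‖(memLp_convection_term hu (V.grad (E.toV v) i) i).toLp _‖
      ≤ M * ‖E.grad v‖ := by
    intro i
    refine (Lp.norm_le_mul_norm_of_ae_le_mul (g := V.grad (E.toV v) i) (c := M) ?_).trans ?_
    · filter_upwards [hu, (memLp_convection_term hu (V.grad (E.toV v) i) i).coeFn_toLp] with x hx h'
      rw [h', norm_smul]
      gcongr
      exact (PiLp.norm_apply_le _ i).trans hx
    · gcongr
      exact norm_grad_apply_le _ i
  have he : (memLp_convection u v).toLp _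
      = (memLp_convection_term hu (V.grad (E.toV v) 0) 0).toLp _
        + (memLp_convection_term hu (V.grad (E.toV v) 1) 1).toLp _ := by
    rw [← MemLp.toLp_add]
    refine MemLp.toLp_congr _ _ (ae_of_all _ fun x => ?_)
    simp only [convection, Fin.sum_univ_two]
    rfl
  rw [he]
  refine (norm_add_le _ _).trans ?_
  linarith [hterm 0, hterm 1]

lemma B_add_left (u u' v : E) : B (E.toV (u + u')) v = B (E.toV u) v + B (E.toV u') v := by
  rw [B_eq, B_eq, B_eq, ← map_add, ← MemLp.toLp_add]
  congr 1
  refine MemLp.toLp_congr _ _ ?_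
  filter_upwards [Lp.coeFn_add (H.toL2 (E.toH u)) (H.toL2 (E.toH u'))] with x hx
  have hx' : H.toL2 (V.toH (E.toV (u + u'))) x = H.toL2 (E.toH u) x + H.toL2 (E.toH u') x := by
    rw [← Pi.add_apply, ← hx, ← map_add, ← map_add]; rfl
  simp only [Pi.add_apply, convection, Fin.sum_univ_two, hx', PiLp.add_apply, add_smul]
  change _ = (H.toL2 (E.toH u) x 0 • _ + H.toL2 (E.toH u) x 1 • _)
    + (H.toL2 (E.toH u') x 0 • _ + H.toL2 (E.toH u') x 1 • _)
  abel

lemma B_smul_left (c : ℝ) (u v : E) : B (E.toV (c • u)) v = c • B (E.toV u) v := by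
  rw [B_eq, B_eq, ← map_smul, ← MemLp.toLp_const_smul]
  congr 1
  refine MemLp.toLp_congr _ _ ?_
  filter_upwards [Lp.coeFn_smul c (H.toL2 (E.toH u))] with x hx
  have hx' : H.toL2 (V.toH (E.toV (c • u))) x = c • H.toL2 (E.toH u) x := by
    rw [← Pi.smul_apply, ← hx, ← map_smul, ← map_smul]; rfl
  simp only [Pi.smul_apply, convection, Fin.sum_univ_two, hx', PiLp.smul_apply, smul_add,
    smul_assoc]
  rfl

lemma B_add_right (u v v' : E) : B (E.toV u) (v + v') = B (E.toV u) v + B (E.toV u) v' := by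
  rw [B_eq, B_eq, B_eq, ← map_add, ← MemLp.toLp_add]
  congr 1
  refine MemLp.toLp_congr _ _ ?_
  filter_upwards [Lp.coeFn_add (V.grad (E.toV v) 0) (V.grad (E.toV v') 0),
    Lp.coeFn_add (V.grad (E.toV v) 1) (V.grad (E.toV v') 1)] with x h0 h1
  simp only [Pi.add_apply, convection, Fin.sum_univ_two, map_add, PiLp.add_apply, h0, h1, smul_add]
  abel

lemma B_smul_right (c : ℝ) (u v : E) : B (E.toV u) (c • v) = c • B (E.toV u) v := by
  rw [B_eq, B_eq, ← map_smul, ← MemLp.toLp_const_smul]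
  congr 1
  refine MemLp.toLp_congr _ _ ?_
  filter_upwards [Lp.coeFn_smul c (V.grad (E.toV v) 0), Lp.coeFn_smul c (V.grad (E.toV v) 1)]
    with x h0 h1
  simp only [Pi.smul_apply, convection, Fin.sum_univ_two, map_smul, PiLp.smul_apply, h0, h1,
    smul_add]
  rw [smul_comm c, smul_comm c]

/-! ### The lower order part of the linearized operator -/

/-- The constant of the embedding of `E` into bounded fields. -/
def embC : ℝ := 2 * Real.sqrt latticeSum * ‖shiftedA 1‖

lemma embC_nonneg : 0 ≤ embC := by unfold embC; positivity

lemma ae_norm_le_embC (u : E) : ∀ᵐ x ∂torusMeasure, ‖H.toL2 (E.toH u) x‖ ≤ embC * ‖u‖ := by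
  filter_upwards [ae_norm_le one_pos u] with x hx
  refine hx.trans ?_
  rw [one_pow, div_one, embC, mul_assoc _ ‖shiftedA 1‖]
  gcongr
  exact (shiftedA 1).le_opNorm u

lemma norm_grad_le (u : E) : ‖E.grad u‖ ≤ ‖u‖ := by
  refine le_of_sq_le_sq ?_ (norm_nonneg _)
  have h1 := V.norm_sq (E.toV u)
  have h2 := E.norm_sq u
  have h3 : 0 ≤ ∑ p : Fin 2 × Fin 2, ‖E.hess p.1 p.2 u‖ ^ 2 :=
    Finset.sum_nonneg fun _ _ => by positivity
  have h4 : ‖E.grad u‖ = ‖V.grad (E.toV u)‖ := rfl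
  rw [h4]
  nlinarith [sq_nonneg ‖V.toH (E.toV u)‖]

lemma norm_toH_le (u : E) : ‖E.toH u‖ ≤ ‖u‖ := by
  refine le_of_sq_le_sq ?_ (norm_nonneg _)
  have h1 := V.norm_sq (E.toV u)
  have h2 := E.norm_sq u
  have h3 : 0 ≤ ∑ p : Fin 2 × Fin 2, ‖E.hess p.1 p.2 u‖ ^ 2 :=
    Finset.sum_nonneg fun _ _ => by positivity
  have h4 : ‖E.toH u‖ = ‖V.toH (E.toV u)‖ := rfl
  rw [h4]
  nlinarith [sq_nonneg ‖V.grad (E.toV u)‖]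

/-- `-B'(ū) ω + |∇ū|² ω + 2 ⟨∇ū, ∇ω⟩ ū`, as a linear map in `ω`. -/
def lowerOrderLin (ubar : E) : E →ₗ[ℝ] H where
  toFun ω := -B' ubar ω + ‖E.grad ubar‖ ^ 2 • E.toH ω
    + (2 * inner ℝ (E.grad ubar) (E.grad ω)) • E.toH ubar
  map_add' ω ω' := by
    rw [B', B_add_left, B_add_right]
    simp only [B', map_add, inner_add_right, smul_add, mul_add, add_smul]
    abel
  map_smul' c ω := by
    rw [B', B_smul_left, B_smul_right]
    simp only [B', map_smul, inner_smul_right, smul_add, smul_neg,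
      RingHom.id_apply, smul_smul, mul_comm _ c, mul_left_comm _ c]

lemma norm_lowerOrderLin_le_add (ubar ω : E) : ‖lowerOrderLin ubar ω‖
    ≤ ‖B (E.toV ubar) ω‖ + ‖B (E.toV ω) ubar‖ + ‖E.grad ubar‖ ^ 2 * ‖E.toH ω‖
      + 2 * (‖E.grad ubar‖ * ‖E.grad ω‖) * ‖E.toH ubar‖ := by
  have h3 : ‖(2 * inner ℝ (E.grad ubar) (E.grad ω)) • E.toH ubar‖
      ≤ 2 * (‖E.grad ubar‖ * ‖E.grad ω‖) * ‖E.toH ubar‖ := by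
    rw [norm_smul, norm_mul, Real.norm_ofNat]
    gcongr
    exact norm_inner_le_norm _ _
  have h2 : ‖‖E.grad ubar‖ ^ 2 • E.toH ω‖ = ‖E.grad ubar‖ ^ 2 * ‖E.toH ω‖ := by
    rw [norm_smul, Real.norm_of_nonneg (by positivity)]
  have h1 : ‖-B' ubar ω‖ ≤ ‖B (E.toV ubar) ω‖ + ‖B (E.toV ω) ubar‖ := by
    rw [norm_neg]; exact norm_add_le _ _
  calc ‖lowerOrderLin ubar ω‖ ≤ ‖-B' ubar ω‖ + ‖‖E.grad ubar‖ ^ 2 • E.toH ω‖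
        + ‖(2 * inner ℝ (E.grad ubar) (E.grad ω)) • E.toH ubar‖ := norm_add₃_le
    _ ≤ _ := by linarith

lemma norm_lowerOrderLin_le (ubar ω : E) : ‖lowerOrderLin ubar ω‖
    ≤ (1 * ‖E.grad ubar‖ ^ 2 + (4 * embC + 1) * ‖ubar‖
      + 2 * 1 * ‖E.toH ubar‖ * ‖E.grad ubar‖) * ‖ω‖ := by
  have h0 := norm_lowerOrderLin_le_add ubar ω
  have hc := embC_nonneg
  have h1 := norm_B_le (by positivity) (ae_norm_le_embC ubar) ω
  have h2 := norm_B_le (by positivity) (ae_norm_le_embC ω) ubar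
  have h3 : 2 * (embC * ‖ubar‖) * ‖E.grad ω‖ ≤ 2 * (embC * ‖ubar‖) * ‖ω‖ := by
    gcongr; exact norm_grad_le ω
  have h4 : 2 * (embC * ‖ω‖) * ‖E.grad ubar‖ ≤ 2 * (embC * ‖ω‖) * ‖ubar‖ := by
    gcongr; exact norm_grad_le ubar
  have h5 : ‖E.grad ubar‖ ^ 2 * ‖E.toH ω‖ ≤ ‖E.grad ubar‖ ^ 2 * ‖ω‖ := by
    gcongr; exact norm_toH_le ω
  have h6 : 2 * (‖E.grad ubar‖ * ‖E.grad ω‖) * ‖E.toH ubar‖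
      ≤ 2 * (‖E.grad ubar‖ * ‖ω‖) * ‖E.toH ubar‖ := by
    gcongr; exact norm_grad_le ω
  -- The two halves of `B'` contribute `2 * embC` each; the extra 1 only ensures that the constant
  -- is positive.
  have h7 : 0 ≤ ‖ubar‖ * ‖ω‖ := by positivity
  linarith

/-- `ω ↦ -B'(ū) ω + |∇ū|² ω + 2 ⟨∇ū, ∇ω⟩ ū`, as a continuous linear map from `E` to `H`. -/
def lowerOrder (ubar : E) : E →L[ℝ] H :=
  (lowerOrderLin ubar).mkContinuous _ (norm_lowerOrderLin_le ubar)

lemma lowerOrder_apply (ubar ω : E) : lowerOrder ubar ω = -B' ubar ω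
    + ‖E.grad ubar‖ ^ 2 • E.toH ω + (2 * inner ℝ (E.grad ubar) (E.grad ω)) • E.toH ubar := rfl

lemma G_eq (ubar ω : E) (U : H) : G ubar U ω = U + lowerOrder ubar ω := by
  rw [G, lowerOrder_apply]; abel

/-- The lower order part is small relative to `A + μ` for large `μ`. -/
lemma exists_norm_lowerOrder_le (ubar : E) :
    ∃ μ : ℝ, 0 ≤ μ ∧ ∀ ω, ‖lowerOrder ubar ω‖ ≤ 2⁻¹ * ‖shiftedA μ ω‖ := by
  set a := ‖E.grad ubar‖
  set c := 2 * (embC * ‖ubar‖)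
  have hc : 0 ≤ c := by have := embC_nonneg; positivity
  have key : ∀ m : ℝ, 0 < m → ∀ ω, ‖lowerOrder ubar ω‖ ≤ (c * m⁻¹
      + 2 * (2 * Real.sqrt (latticeSum / m)) * a + a ^ 2 * (m⁻¹) ^ 2
      + 2 * a * ‖E.toH ubar‖ * m⁻¹) * ‖shiftedA (m ^ 2) ω‖ := by
    intro m hm ω
    have h0 : ‖lowerOrder ubar ω‖ ≤ _ := norm_lowerOrderLin_le_add ubar ω
    set N := ‖shiftedA (m ^ 2) ω‖
    have hg : ‖E.grad ω‖ ≤ m⁻¹ * N := by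
      rw [inv_mul_eq_div, le_div_iff₀ hm]
      refine le_of_sq_le_sq ?_ (norm_nonneg _)
      have := mul_norm_grad_sq_le (sq_nonneg m) ω
      linarith
    have hh : ‖E.toH ω‖ ≤ (m⁻¹) ^ 2 * N := by
      rw [inv_pow, inv_mul_eq_div, le_div_iff₀ (by positivity)]
      have := mul_norm_toH_le (sq_nonneg m) ω
      linarith
    have h1 : ‖B (E.toV ubar) ω‖ ≤ c * (m⁻¹ * N) :=
      (norm_B_le (by have := embC_nonneg; positivity) (ae_norm_le_embC ubar) ω).trans (by gcongr)
    -- Here `ω` is the undifferentiated factor, so the gain in `m` has to come from its sup norm.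
    have h2 : ‖B (E.toV ω) ubar‖ ≤ 2 * (2 * Real.sqrt (latticeSum / m) * N) * a :=
      norm_B_le (by positivity) (ae_norm_le hm ω) ubar
    have h3 : a ^ 2 * ‖E.toH ω‖ ≤ a ^ 2 * ((m⁻¹) ^ 2 * N) := by gcongr
    have h4 : 2 * (a * ‖E.grad ω‖) * ‖E.toH ubar‖ ≤ 2 * (a * (m⁻¹ * N)) * ‖E.toH ubar‖ := by
      gcongr
    linarith
  have hlim : Filter.Tendsto (fun m : ℝ => c * m⁻¹
      + 2 * (2 * Real.sqrt (latticeSum / m)) * a + a ^ 2 * (m⁻¹) ^ 2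
      + 2 * a * ‖E.toH ubar‖ * m⁻¹) Filter.atTop (nhds 0) := by
    have hi := tendsto_inv_atTop_zero (𝕜 := ℝ)
    have hs : Filter.Tendsto (fun m : ℝ => Real.sqrt (latticeSum / m)) Filter.atTop (nhds 0) := by
      have := (hi.const_mul latticeSum).sqrt
      simpa [div_eq_mul_inv] using this
    have := (((hi.const_mul c).add (((hs.const_mul 2).const_mul 2).mul_const a)).add
      ((hi.pow 2).const_mul (a ^ 2))).add (hi.const_mul (2 * a * ‖E.toH ubar‖))
    simpa using this
  obtain ⟨m, h1, h2⟩ := ((hlim.eventually_lt_const (by norm_num : (0 : ℝ) < 2⁻¹)).and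
    (Filter.eventually_gt_atTop 0)).exists
  exact ⟨m ^ 2, sq_nonneg m, fun ω => (key m h2 ω).trans (by gcongr)⟩

/-! ### Lipschitz continuity of `G` -/

lemma norm_toE_le {T : ℝ} (ω : X T) : ‖ω.toE‖ ≤ ‖ω‖ := norm_snd_le ω.1

lemma X.toE_sub {T : ℝ} (ω ω' : X T) : (ω - ω').toE = ω.toE - ω'.toE := rfl

lemma exists_lipschitz_G (ubar : E) (T : ℝ) (U : L2Time T H) :
    ∃ Φ : X T → L2Time T H,
      (∀ ω : X T, ∀ᵐ t ∂timeMeasure T, Φ ω t = G ubar (U t) (ω.toE t)) ∧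
      ∀ ω₁ ω₂ : X T, ‖Φ ω₁ - Φ ω₂‖ ≤
        (1 * ‖E.grad ubar‖ ^ 2 + (4 * embC + 1) * ‖ubar‖
          + 2 * 1 * ‖E.toH ubar‖ * ‖E.grad ubar‖) * ‖ω₁ - ω₂‖ := by
  set K := 1 * ‖E.grad ubar‖ ^ 2 + (4 * embC + 1) * ‖ubar‖
    + 2 * 1 * ‖E.toH ubar‖ * ‖E.grad ubar‖
  have hK0 : 0 ≤ K := by have := embC_nonneg; positivity
  have hK : ‖lowerOrder ubar‖ ≤ K := LinearMap.mkContinuous_norm_le _ hK0 _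
  refine ⟨fun ω => U + (lowerOrder ubar).compLpL 2 (timeMeasure T) ω.toE, fun ω => ?_,
    fun ω₁ ω₂ => ?_⟩
  · filter_upwards [Lp.coeFn_add U ((lowerOrder ubar).compLpL 2 (timeMeasure T) ω.toE),
      (lowerOrder ubar).coeFn_compLpL (p := 2) ω.toE] with t h1 h2
    rw [h1, Pi.add_apply, h2, G_eq]
  · rw [add_sub_add_left_eq_sub, ← map_sub, ← X.toE_sub]
    refine ((lowerOrder ubar).norm_compLp_le _).trans ?_
    gcongr
    exact norm_toE_le _

/-! ### Scalar linear equations with square integrable right hand side -/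

/-- On `[0, T]` the function `f` is the primitive of the integrable function `f'`. -/
def IsPrimitive (T : ℝ) (f f' : ℝ → ℝ) : Prop :=
  IntervalIntegrable f' volume 0 T ∧ ∀ t ∈ Icc 0 T, f t = f 0 + ∫ s in 0..t, f' s

lemma IsPrimitive.of_hasDerivAt {T : ℝ} {f f' : ℝ → ℝ} (h : ∀ t, HasDerivAt f (f' t) t)
    (hc : Continuous f') : IsPrimitive T f f' := by
  refine ⟨hc.intervalIntegrable _ _, fun t _ => ?_⟩
  rw [intervalIntegral.integral_eq_sub_of_hasDerivAt (fun s _ => h s) (hc.intervalIntegrable _ _)]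
  ring

lemma IsPrimitive.of_integral {T : ℝ} {f' : ℝ → ℝ} (h : IntervalIntegrable f' volume 0 T) (a : ℝ) :
    IsPrimitive T (fun t => a + ∫ s in 0..t, f' s) f' :=
  ⟨h, fun t _ => by simp⟩

lemma IsPrimitive.intervalIntegrable {T : ℝ} {f f' : ℝ → ℝ} (h : IsPrimitive T f f') {t : ℝ}
    (ht : t ∈ Icc 0 T) : IntervalIntegrable f' volume 0 t :=
  h.1.mono_set (by
    rw [uIcc_of_le ht.1, uIcc_of_le (ht.1.trans ht.2)]
    exact Icc_subset_Icc_right ht.2)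

lemma IsPrimitive.continuousOn {T : ℝ} (hT : 0 ≤ T) {f f' : ℝ → ℝ} (h : IsPrimitive T f f') :
    ContinuousOn f (Icc 0 T) := by
  have := (intervalIntegral.continuousOn_primitive_interval' h.1 left_mem_uIcc).const_add (f 0)
  rw [uIcc_of_le hT] at this
  exact this.congr h.2

/-- Primitives of integrable functions are absolutely continuous, and the fundamental theorem of
calculus for products holds for these, with derivatives only almost everywhere. -/
lemma IsPrimitive.mul {T : ℝ} (hT : 0 ≤ T) {f f' g g' : ℝ → ℝ} (hf : IsPrimitive T f f')
    (hg : IsPrimitive T g g') :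
    IsPrimitive T (fun t => f t * g t) (fun t => f' t * g t + f t * g' t) := by
  have hcf := hf.continuousOn hT
  have hcg := hg.continuousOn hT
  refine ⟨?_, fun t ht => ?_⟩
  · rw [← uIcc_of_le hT] at hcf hcg
    exact (hf.1.mul_continuousOn hcg).add (hg.1.continuousOn_mul hcf)
  have hF := ((hf.intervalIntegrable ht).absolutelyContinuousOnInterval_intervalIntegral
    (c := 0) left_mem_uIcc)
  have hG := ((hg.intervalIntegrable ht).absolutelyContinuousOnInterval_intervalIntegral
    (c := 0) left_mem_uIcc)
  have hconst : ∀ c : ℝ, AbsolutelyContinuousOnInterval (fun _ : ℝ => c) 0 t := fun c =>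
    (contDiff_const (n := 1)).contDiffOn.absolutelyContinuousOnInterval
  have key := AbsolutelyContinuousOnInterval.integral_deriv_mul_eq_sub
    ((hconst (f 0)).add hF) ((hconst (g 0)).add hG)
  simp only [Pi.add_apply, intervalIntegral.integral_same, add_zero, ← hf.2 t ht,
    ← hg.2 t ht] at key
  have hquad : ∫ s in 0..t, (f' s * g s + f s * g' s) = f t * g t - f 0 * g 0 := by
    rw [← key]
    refine intervalIntegral.integral_congr_ae ?_
    filter_upwards [(hf.intervalIntegrable ht).ae_hasDerivAt_integral,
      (hg.intervalIntegrable ht).ae_hasDerivAt_integral] with s h1 h2 hs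
    have hs' : s ∈ uIcc 0 t := uIoc_subset_uIcc hs
    have hs'' : s ∈ Icc 0 T := by
      rw [uIcc_of_le ht.1] at hs'
      exact ⟨hs'.1, hs'.2.trans ht.2⟩
    have d1 : HasDerivAt ((fun _ => f 0) + fun x => ∫ v in 0..x, f' v) (f' s) s := by
      simpa using (hasDerivAt_const s (f 0)).add (h1 hs' 0 left_mem_uIcc)
    have d2 : HasDerivAt ((fun _ => g 0) + fun x => ∫ v in 0..x, g' v) (g' s) s := by
      simpa using (hasDerivAt_const s (g 0)).add (h2 hs' 0 left_mem_uIcc)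
    rw [d1.deriv, d2.deriv, ← hf.2 s hs'', ← hg.2 s hs'']
  change f t * g t = f 0 * g 0 + _
  rw [hquad]
  ring

lemma isPrimitive_exp (T c : ℝ) :
    IsPrimitive T (fun t => Real.exp (c * t)) (fun t => c * Real.exp (c * t)) := by
  refine IsPrimitive.of_hasDerivAt (fun t => ?_) (by fun_prop)
  have := ((hasDerivAt_id t).const_mul c).exp
  simpa [mul_comm] using this

/-- The Duhamel formula solves `y' = g - l y`. -/
lemma exists_scalar_solution {T : ℝ} (hT : 0 ≤ T) {g : ℝ → ℝ}
    (hg : IntervalIntegrable g volume 0 T) (l a : ℝ) :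
    ∃ y : ℝ → ℝ, y 0 = a ∧ IsPrimitive T y fun t => g t - l * y t := by
  have h1 := IsPrimitive.of_integral (hg.continuousOn_mul
    (g := fun t => Real.exp (l * t)) (by fun_prop)) a
  have h2 := (isPrimitive_exp T (-l)).mul hT h1
  refine ⟨fun t => Real.exp (-l * t) * (a + ∫ s in 0..t, Real.exp (l * s) * g s), by simp, ?_⟩
  convert h2 using 2 with t
  have : Real.exp (-l * t) * Real.exp (l * t) = 1 := by
    rw [← Real.exp_add]; simp
  linear_combination (-g t) * this

/-- The weighted energy estimate for `y' = g - l y`. -/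
lemma scalar_energy {T : ℝ} (hT : 0 ≤ T) {y g : ℝ → ℝ} {l μ : ℝ}
    (hy : IsPrimitive T y fun t => g t - l * y t)
    (hg : IntervalIntegrable (fun t => g t ^ 2) volume 0 T) {t : ℝ} (ht : t ∈ Icc 0 T) :
    (l + μ) * (Real.exp (-μ * t) * y t) ^ 2
        + ∫ s in 0..t, ((l + μ) * (Real.exp (-μ * s) * y s)) ^ 2
      ≤ (l + μ) * y 0 ^ 2 + ∫ s in 0..t, (Real.exp (-μ * s) * g s) ^ 2 := by
  set z : ℝ → ℝ := fun t => Real.exp (-μ * t) * y t with hz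
  set γ : ℝ → ℝ := fun t => Real.exp (-μ * t) * g t with hγ
  -- The weight `e^{-μt}` raises the decay rate from `l` to `l + μ`.
  have h1 : IsPrimitive T z fun t => γ t - (l + μ) * z t := by
    convert (isPrimitive_exp T (-μ)).mul hT hy using 2 with t
    simp only [hz, hγ]
    ring
  have h2 := (h1.mul hT h1)
  have hzc := h1.continuousOn hT
  have hsub : Icc 0 t ⊆ Icc 0 T := Icc_subset_Icc_right ht.2
  have hzi : IntervalIntegrable (fun s => ((l + μ) * z s) ^ 2) volume 0 t := by
    refine ContinuousOn.intervalIntegrable ?_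
    rw [uIcc_of_le ht.1]
    exact (((hzc.mono hsub).const_smul (l + μ)).pow 2)
  have hγi : IntervalIntegrable (fun s => γ s ^ 2) volume 0 t := by
    have h : IntervalIntegrable (fun s => g s ^ 2) volume 0 t := hg.mono_set (by
      rw [uIcc_of_le ht.1, uIcc_of_le hT]; exact hsub)
    simp only [hγ, mul_pow]
    exact h.continuousOn_mul (by fun_prop)
  have h3 := h2.2 t ht
  have h4 : (l + μ) * ∫ s in 0..t, ((γ s - (l + μ) * z s) * z s + z s * (γ s - (l + μ) * z s))
      ≤ (∫ s in 0..t, γ s ^ 2) - ∫ s in 0..t, ((l + μ) * z s) ^ 2 := by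
    rw [← intervalIntegral.integral_const_mul, ← intervalIntegral.integral_sub hγi hzi]
    refine intervalIntegral.integral_mono_on ht.1 ((h2.intervalIntegrable ht).const_mul _)
      (hγi.sub hzi) fun s _ => ?_
    -- With `a = (l + μ)z` this is `2a(γ - a) ≤ γ² - a²`, that is, `(γ - a)² ≥ 0`; hence the
    -- constant one.
    nlinarith [sq_nonneg (γ s - (l + μ) * z s)]
  have h5 : z 0 = y 0 := by simp [hz]
  simp only [h5] at h3
  have h6 : (l + μ) * z t ^ 2 = (l + μ) * y 0 ^ 2 + (l + μ) *
      ∫ s in 0..t, ((γ s - (l + μ) * z s) * z s + z s * (γ s - (l + μ) * z s)) := by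
    rw [sq, h3]; ring
  linarith

/-! ### Integrals over `[0, T]` as a subtype -/

instance (T : ℝ) : IsFiniteMeasure (timeMeasure T) :=
  ⟨by
    rw [Measure.comap_apply _ Subtype.val_injective (fun s hs => measurableSet_Icc.subtype_image hs)
      _ MeasurableSet.univ, image_univ, Subtype.range_coe]
    exact measure_Icc_lt_top⟩

lemma map_timeMeasure (T : ℝ) :
    (timeMeasure T).map Subtype.val = volume.restrict (Icc (0 : ℝ) T) :=
  (MeasurableEmbedding.subtype_coe measurableSet_Icc).map_comap volume |>.trans
    (by rw [Subtype.range_coe])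

section

variable {F : Type*} [NormedAddCommGroup F] {T : ℝ}

/-- The extension of a function on `[0, T]` to the real line, constant outside `[0, T]`. -/
abbrev extend (hT : 0 ≤ T) (f : Icc (0 : ℝ) T → F) : ℝ → F := fun t => f (projIcc 0 T hT t)

lemma integrableOn_extend (hT : 0 ≤ T) {f : Icc (0 : ℝ) T → F} (hf : Integrable f (timeMeasure T)) :
    IntervalIntegrable (extend hT f) volume 0 T := by
  rw [intervalIntegrable_iff_integrableOn_Icc_of_le hT, IntegrableOn, ← map_timeMeasure,
    (MeasurableEmbedding.subtype_coe measurableSet_Icc).integrable_map_iff]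
  refine hf.congr (ae_of_all _ fun t => ?_)
  simp [extend]

lemma setIntegral_extend [NormedSpace ℝ F] (hT : 0 ≤ T) (f : Icc (0 : ℝ) T → F)
    {s t : Icc (0 : ℝ) T} (hst : s ≤ t) :
    ∫ r in Ioc s t, f r ∂timeMeasure T = ∫ r in (s : ℝ)..t, extend hT f r := by
  have hst' : (s : ℝ) ≤ t := hst
  have hsub : Ioc (s : ℝ) t ⊆ Icc 0 T := fun r hr => ⟨s.2.1.trans hr.1.le, hr.2.trans t.2.2⟩
  rw [intervalIntegral.integral_of_le hst']
  have h1 : (volume : Measure ℝ).restrict (Ioc (s : ℝ) t)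
      = ((timeMeasure T).map Subtype.val).restrict (Ioc (s : ℝ) t) := by
    rw [map_timeMeasure, Measure.restrict_restrict measurableSet_Ioc, inter_eq_left.2 hsub]
  rw [h1, (MeasurableEmbedding.subtype_coe measurableSet_Icc).setIntegral_map]
  have h2 : (Subtype.val ⁻¹' Ioc (s : ℝ) t : Set (Icc (0 : ℝ) T)) = Ioc s t := rfl
  rw [h2]
  simp [extend]

lemma integral_extend [NormedSpace ℝ F] (hT : 0 ≤ T) (f : Icc (0 : ℝ) T → F) :
    ∫ r, f r ∂timeMeasure T = ∫ r in 0..T, extend hT f r := by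
  rw [intervalIntegral.integral_of_le hT, ← integral_Icc_eq_integral_Ioc, ← map_timeMeasure,
    (MeasurableEmbedding.subtype_coe measurableSet_Icc).integral_map]
  simp [extend]

end

/-! ### Exponential weights in time -/

section

variable {T : ℝ} {F : Type} [NormedAddCommGroup F] [NormedSpace ℝ F]

lemma memLp_weight (μ : ℝ) (f : L2Time T F) :
    MemLp (fun t : Icc (0 : ℝ) T => Real.exp (-μ * t) • f t) 2 (timeMeasure T) := by
  have hc : Continuous fun t : Icc (0 : ℝ) T => Real.exp (-μ * t) := by fun_prop
  obtain ⟨C, hC⟩ := isCompact_univ.exists_bound_of_continuousOn hc.continuousOn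
  refine (Lp.memLp f).of_le_mul (c := C)
    (hc.aestronglyMeasurable.smul (Lp.memLp f).aestronglyMeasurable) (ae_of_all _ fun t => ?_)
  rw [norm_smul]
  gcongr
  exact hC t (mem_univ t)

/-- Multiplication by the weight `exp (-μ t)` in `L²(0, T; F)`. -/
def weight (μ : ℝ) (f : L2Time T F) : L2Time T F := (memLp_weight μ f).toLp _

lemma coeFn_weight (μ : ℝ) (f : L2Time T F) :
    ∀ᵐ t ∂timeMeasure T, weight μ f t = Real.exp (-μ * t) • f t := (memLp_weight μ f).coeFn_toLp

lemma weight_sub (μ : ℝ) (f g : L2Time T F) : weight μ (f - g) = weight μ f - weight μ g := by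
  refine Lp.ext ?_
  filter_upwards [coeFn_weight μ (f - g), coeFn_weight μ f, coeFn_weight μ g, Lp.coeFn_sub f g,
    Lp.coeFn_sub (weight μ f) (weight μ g)] with t h1 h2 h3 h4 h5
  rw [h1, h5, Pi.sub_apply, h2, h3, h4, Pi.sub_apply, smul_sub]

lemma weight_weight_neg (μ : ℝ) (f : L2Time T F) : weight μ (weight (-μ) f) = f := by
  refine Lp.ext ?_
  filter_upwards [coeFn_weight μ (weight (-μ) f), coeFn_weight (-μ) f] with t h1 h2
  rw [h1, h2, smul_smul, ← Real.exp_add]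
  simp

lemma weight_injective (μ : ℝ) : Function.Injective (weight μ : L2Time T F → L2Time T F) := by
  have h : Function.LeftInverse (weight (-μ)) (weight μ : L2Time T F → L2Time T F) := fun f => by
    simpa using weight_weight_neg (-μ) f
  exact h.injective

lemma norm_weight_le {F' : Type} [NormedAddCommGroup F'] [NormedSpace ℝ F'] (μ : ℝ) {c : ℝ}
    {f : L2Time T F} {g : L2Time T F'} (h : ∀ᵐ t ∂timeMeasure T, ‖f t‖ ≤ c * ‖g t‖) :
    ‖weight μ f‖ ≤ c * ‖weight μ g‖ := by
  refine Lp.norm_le_mul_norm_of_ae_le_mul ?_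
  filter_upwards [coeFn_weight μ f, coeFn_weight μ g, h] with t h1 h2 h3
  rw [h1, h2, norm_smul, norm_smul, mul_left_comm]
  gcongr

end

/-! ### Coordinates of time dependent fields -/

lemma X.ae_eq {T : ℝ} (ω : X T) : ∀ᵐ t ∂timeMeasure T, E.toV (ω.toE t) = ω.path t := ω.2

lemma memLp_inner_eigenH {T : ℝ} (h : L2Time T H) (k : NZFreq) :
    MemLp (fun t => inner ℝ (eigenH k) (h t)) 2 (timeMeasure T) :=
  (innerSL ℝ (eigenH k)).comp_memLp h

lemma integrable_of_memLp_two {T : ℝ} {F : Type} [NormedAddCommGroup F] {f : Icc (0 : ℝ) T → F}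
    (h : MemLp f 2 (timeMeasure T)) : Integrable f (timeMeasure T) :=
  h.integrable (by norm_num)

lemma norm_sq_L2Time {T : ℝ} {F : Type} [NormedAddCommGroup F] [InnerProductSpace ℝ F]
    (h : L2Time T F) : ‖h‖ ^ 2 = ∫ t, ‖h t‖ ^ 2 ∂timeMeasure T := by
  rw [← real_inner_self_eq_norm_sq, L2.inner_def]
  simp only [real_inner_self_eq_norm_sq]

/-- Parseval at each time, integrated term by term with `|h(t)|²` as integrable bound. -/
lemma hasSum_integral_sq {T : ℝ} (h : L2Time T H) :
    HasSum (fun k => ∫ t, inner ℝ (eigenH k) (h t) ^ 2 ∂timeMeasure T) (‖h‖ ^ 2) := by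
  rw [norm_sq_L2Time]
  refine hasSum_integral_of_dominated_convergence
    (fun k t => inner ℝ (eigenH k) (h t) ^ 2) (fun k => ?_) (fun k => ?_) ?_ ?_ ?_
  · exact (memLp_inner_eigenH h k).integrable_sq.aestronglyMeasurable
  · exact ae_of_all _ fun t => by rw [Real.norm_of_nonneg (sq_nonneg _)]
  · exact ae_of_all _ fun t => (hasSum_sq_inner_eigenH (h t)).summable
  · simp only [(hasSum_sq_inner_eigenH _).tsum_eq]
    exact (Lp.memLp h).integrable_norm_pow (by norm_num)
  · exact ae_of_all _ fun t => hasSum_sq_inner_eigenH (h t)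

/-! ### The Stokes evolution equation -/

/-- `ω ∈ X_T` solves `ω_t + A ω = f`. -/
def IsStokesSolution {T : ℝ} (f : L2Time T H) (ω : X T) : Prop :=
  ∃ w : L2Time T H, HasTimeDeriv ω.path w ∧ ∀ᵐ t ∂timeMeasure T, w t + A (ω.toE t) = f t

/-- The coordinate of frequency `k` of `ω ∈ X_T`. -/
def coord {T : ℝ} (ω : X T) (k : NZFreq) (t : Icc (0 : ℝ) T) : ℝ :=
  inner ℝ (eigenH k) (V.toH (ω.path t))

lemma continuous_coord {T : ℝ} (ω : X T) (k : NZFreq) : Continuous (coord ω k) :=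
  (innerSL ℝ (eigenH k)).continuous.comp (V.toH.continuous.comp ω.path.continuous)

/-- Pairing with an eigenfunction turns the evolution equation into the scalar equation `y' = g - λ
y`. -/
lemma IsStokesSolution.isPrimitive_coord {T : ℝ} (hT : 0 ≤ T) {f : L2Time T H} {ω : X T}
    (h : IsStokesSolution f ω) (k : NZFreq) :
    IsPrimitive T (extend hT (coord ω k)) fun t =>
      extend hT (fun t => inner ℝ (eigenH k) (f t)) t - lam k * extend hT (coord ω k) t := by
  obtain ⟨w, hw, he⟩ := h
  have hi1 := integrableOn_extend hT (integrable_of_memLp_two (memLp_inner_eigenH f k))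
  have hc : Continuous (extend hT (coord ω k)) :=
    (continuous_coord ω k).comp continuous_projIcc
  refine ⟨hi1.sub ((hc.intervalIntegrable _ _).const_mul _), fun t ht => ?_⟩
  have h1 := hw ⟨0, left_mem_Icc.2 hT⟩ ⟨t, ht⟩ ht.1
  have h2 := congrArg (fun u => inner ℝ (eigenH k) u) h1
  simp only [inner_sub_right] at h2
  have hwi : Integrable w (timeMeasure T) := integrable_of_memLp_two (Lp.memLp w)
  have h3 : inner ℝ (eigenH k) (∫ r in Ioc (⟨0, left_mem_Icc.2 hT⟩ : Icc (0 : ℝ) T) ⟨t, ht⟩,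
      w r ∂timeMeasure T) = ∫ r in Ioc (⟨0, left_mem_Icc.2 hT⟩ : Icc (0 : ℝ) T) ⟨t, ht⟩,
        (inner ℝ (eigenH k) (f r) - lam k * coord ω k r) ∂timeMeasure T := by
    rw [← integral_inner hwi.integrableOn]
    refine integral_congr_ae (ae_restrict_of_ae ?_)
    filter_upwards [he, ω.ae_eq] with r h1 h2
    rw [← h1, inner_add_right, inner_eigenH_A, coord, ← h2]
    change _ = _ + _ - _ * inner ℝ (eigenH k) (E.toH (ω.toE r))
    ring
  rw [h3, setIntegral_extend hT _ (show (⟨0, left_mem_Icc.2 hT⟩ : Icc (0 : ℝ) T) ≤ ⟨t, ht⟩ from ht.1)]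
    at h2
  have e0 : projIcc 0 T hT 0 = ⟨0, left_mem_Icc.2 hT⟩ := projIcc_left hT
  have et : projIcc 0 T hT t = ⟨t, ht⟩ := projIcc_of_mem hT ht
  simp only [extend, e0, et]
  simp only [extend] at h2
  rw [← h2, coord, coord]
  ring

lemma IsStokesSolution.sub {T : ℝ} {f f' : L2Time T H} {ω ω' : X T}
    (h : IsStokesSolution f ω) (h' : IsStokesSolution f' ω') :
    IsStokesSolution (f - f') (ω - ω') := by
  obtain ⟨w, hw, he⟩ := h
  obtain ⟨w', hw', he'⟩ := h'
  refine ⟨w - w', fun s t hst => ?_, ?_⟩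
  · have hi : Integrable w (timeMeasure T) := integrable_of_memLp_two (Lp.memLp w)
    have hi' : Integrable w' (timeMeasure T) := integrable_of_memLp_two (Lp.memLp w')
    have h1 : ∫ r in Ioc s t, (w - w') r ∂timeMeasure T
        = ∫ r in Ioc s t, (w r - w' r) ∂timeMeasure T :=
      integral_congr_ae (ae_restrict_of_ae (Lp.coeFn_sub w w'))
    rw [h1, integral_sub hi.integrableOn hi'.integrableOn, ← hw s t hst, ← hw' s t hst]
    have h2 : ∀ r, (ω - ω').path r = ω.path r - ω'.path r := fun r => rfl
    rw [h2, h2, map_sub, map_sub]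
    abel
  · rw [X.toE_sub]
    filter_upwards [he, he', Lp.coeFn_sub w w', Lp.coeFn_sub f f', Lp.coeFn_sub ω.toE ω'.toE]
      with t h1 h2 h3 h4 h5
    rw [h3, h4, h5, Pi.sub_apply, Pi.sub_apply, Pi.sub_apply, ← h1, ← h2, map_sub]
    abel

/-- `(A + μ) ω` as an element of `L²(0, T; H)`. -/
abbrev shiftedPath {T : ℝ} (μ : ℝ) (ω : X T) : L2Time T H :=
  (shiftedA μ).compLpL 2 (timeMeasure T) ω.toE

/-- The weighted energy estimate for the Stokes evolution equation with zero initial value. -/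
lemma IsStokesSolution.norm_weight_shiftedPath_le {T : ℝ} (hT : 0 ≤ T) {f : L2Time T H} {ω : X T}
    (h : IsStokesSolution f ω) (h0 : ω.path ⟨0, left_mem_Icc.2 hT⟩ = 0) {μ : ℝ} (hμ : 0 ≤ μ) :
    ‖weight μ (shiftedPath μ ω)‖ ≤ ‖weight μ f‖ := by
  refine le_of_sq_le_sq (hasSum_le (fun k => ?_) (hasSum_integral_sq _) (hasSum_integral_sq _))
    (norm_nonneg _)
  have h1 : ∫ t, inner ℝ (eigenH k) (weight μ (shiftedPath μ ω) t) ^ 2 ∂timeMeasure T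
      = ∫ t in 0..T, ((lam k + μ) * (Real.exp (-μ * t) * extend hT (coord ω k) t)) ^ 2 := by
    have : ∀ᵐ t ∂timeMeasure T, inner ℝ (eigenH k) (weight μ (shiftedPath μ ω) t) ^ 2
        = ((lam k + μ) * (Real.exp (-μ * t) * coord ω k t)) ^ 2 := by
      filter_upwards [coeFn_weight μ (shiftedPath μ ω),
        (shiftedA μ).coeFn_compLpL (p := 2) ω.toE, ω.ae_eq] with t h1 h2 h3
      rw [h1, h2, inner_smul_right, inner_eigenH_shiftedA, coord, ← h3]
      change (_ * (_ * inner ℝ (eigenH k) (V.toH (E.toV (ω.toE t))))) ^ 2 = _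
      ring
    rw [integral_congr_ae this, integral_extend hT]
    refine intervalIntegral.integral_congr fun t ht => ?_
    rw [uIcc_of_le hT] at ht
    simp only [extend, projIcc_of_mem hT ht]
  have h2 : ∫ t, inner ℝ (eigenH k) (weight μ f t) ^ 2 ∂timeMeasure T
      = ∫ t in 0..T, (Real.exp (-μ * t) * extend hT (fun t => inner ℝ (eigenH k) (f t)) t) ^ 2 := by
    have : ∀ᵐ t ∂timeMeasure T, inner ℝ (eigenH k) (weight μ f t) ^ 2
        = (Real.exp (-μ * t) * inner ℝ (eigenH k) (f t)) ^ 2 := by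
      filter_upwards [coeFn_weight μ f] with t h1
      rw [h1, inner_smul_right]
    rw [integral_congr_ae this, integral_extend hT]
    refine intervalIntegral.integral_congr fun t ht => ?_
    rw [uIcc_of_le hT] at ht
    simp only [extend, projIcc_of_mem hT ht]
  have hg : IntervalIntegrable (fun t => extend hT (fun t => inner ℝ (eigenH k) (f t)) t ^ 2)
      volume 0 T :=
    integrableOn_extend hT (memLp_inner_eigenH f k).integrable_sq
  have h3 := scalar_energy hT (μ := μ) (h.isPrimitive_coord hT k) hg (right_mem_Icc.2 hT)
  have h4 : extend hT (coord ω k) 0 = 0 := by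
    simp only [extend, projIcc_left, coord, h0, map_zero, inner_zero_right]
  rw [h1, h2]
  rw [h4] at h3
  have := lam_nonneg k
  -- The boundary term at time `T` is nonnegative and is dropped.
  have : 0 ≤ (lam k + μ) * (Real.exp (-μ * T) * extend hT (coord ω k) T) ^ 2 := by positivity
  linarith

/-! ### Completeness of `X_T` and smooth paths -/

/-- The compatibility condition equates two continuous maps into `L²(0,T;V)`, so it is closed. -/
instance (T : ℝ) : CompleteSpace (X T) := by
  have hc : IsClosed (graphX T : Set (C(Icc (0 : ℝ) T, V) × L2Time T E)) := by
    have : (graphX T : Set (C(Icc (0 : ℝ) T, V) × L2Time T E))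
        = {w | E.toV.compLpL 2 (timeMeasure T) w.2
          = ContinuousMap.toLp (E := V) 2 (timeMeasure T) ℝ w.1} := by
      ext w
      change (∀ᵐ t ∂timeMeasure T, E.toV (w.2 t) = w.1 t) ↔ _ = _
      rw [Lp.ext_iff]
      have h1 := E.toV.coeFn_compLpL (p := 2) w.2
      have h2 := ContinuousMap.coeFn_toLp (E := V) (p := 2) (𝕜 := ℝ) (timeMeasure T) w.1
      constructor
      · intro h
        filter_upwards [h, h1, h2] with t h h1 h2
        rw [h1, h2, h]
      · intro h
        filter_upwards [h, h1, h2] with t h h1 h2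
        rw [← h1, ← h2, h]
    rw [this]
    exact isClosed_eq (by fun_prop) (by fun_prop)
  exact hc.completeSpace_coe

/-- A continuous `E`-valued path as an element of `X_T`. -/
def ofPath {T : ℝ} (c : C(Icc (0 : ℝ) T, E)) : X T :=
  ⟨((E.toV : C(E, V)).comp c, ContinuousMap.toLp (E := E) 2 (timeMeasure T) ℝ c), by
    change ∀ᵐ t ∂timeMeasure T, E.toV (ContinuousMap.toLp (E := E) 2 (timeMeasure T) ℝ c t)
      = E.toV (c t)
    filter_upwards [ContinuousMap.coeFn_toLp (E := E) (p := 2) (𝕜 := ℝ) (timeMeasure T) c]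
      with t h
    rw [h]⟩

lemma ofPath_sum {T : ℝ} {ι : Type*} (s : Finset ι) (c : ι → C(Icc (0 : ℝ) T, E)) :
    ∑ i ∈ s, ofPath (c i) = ofPath (∑ i ∈ s, c i) := by
  let J : C(Icc (0 : ℝ) T, E) →+ X T :=
    { toFun := ofPath
      map_zero' := by
        refine Subtype.ext (Prod.ext ?_ (map_zero _))
        ext1 t
        exact map_zero E.toV
      map_add' := fun a b => by
        refine Subtype.ext (Prod.ext ?_ (map_add _ _ _))
        ext1 t
        exact map_add E.toV _ _ }
  exact (map_sum J c s).symm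

lemma norm_ofPath_le {T : ℝ} {c : C(Icc (0 : ℝ) T, E)} {M : ℝ}
    (h1 : ∀ t, ‖E.toV (c t)‖ ^ 2 ≤ M) (h2 : ∫ t, ‖c t‖ ^ 2 ∂timeMeasure T ≤ M) :
    ‖ofPath c‖ ≤ Real.sqrt M := by
  change ‖((E.toV : C(E, V)).comp c, ContinuousMap.toLp (E := E) 2 (timeMeasure T) ℝ c)‖ ≤ _
  rw [Prod.norm_def]
  refine max_le ?_ ?_
  · rw [ContinuousMap.norm_le _ (Real.sqrt_nonneg _)]
    exact fun t => Real.le_sqrt_of_sq_le (h1 t)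
  · refine Real.le_sqrt_of_sq_le ?_
    rw [norm_sq_L2Time]
    refine le_trans (le_of_eq (integral_congr_ae ?_)) h2
    filter_upwards [ContinuousMap.coeFn_toLp (E := E) (p := 2) (𝕜 := ℝ) (timeMeasure T) c]
      with t h
    rw [h]

/-- Evaluation at time `t`, as a continuous linear map on `X_T`. -/
def X.evalL {T : ℝ} (t : Icc (0 : ℝ) T) : X T →L[ℝ] V :=
  (ContinuousMap.evalCLM ℝ t).comp
    ((ContinuousLinearMap.fst ℝ C(Icc (0 : ℝ) T, V) (L2Time T E)).comp (graphX T).subtypeL)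

/-! ### Finite combinations of eigenfunctions -/

lemma toH_sum_eigenE (s : Finset NZFreq) (a : NZFreq → ℝ) :
    E.toH (∑ k ∈ s, a k • eigenE k) = ∑ k ∈ s, a k • eigenH k := by
  simp only [map_sum, map_smul, toH_eigenE]

lemma A_sum_eigenE (s : Finset NZFreq) (a : NZFreq → ℝ) :
    A (∑ k ∈ s, a k • eigenE k) = ∑ k ∈ s, (lam k * a k) • eigenH k := by
  simp only [map_sum, map_smul, A_eigenE, smul_smul, mul_comm]

/-- The `H` part is absorbed by the gradient part because all eigenvalues are at least one; hence
the 2. -/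
lemma norm_toV_sum_eigenE_sq_le (s : Finset NZFreq) (a : NZFreq → ℝ) :
    ‖E.toV (∑ k ∈ s, a k • eigenE k)‖ ^ 2 ≤ 2 * ∑ k ∈ s, lam k * a k ^ 2 := by
  refine (norm_toV_sq_le _).trans ?_
  rw [← real_inner_self_eq_norm_sq, toH_sum_eigenE, A_sum_eigenE,
    orthonormal_eigenH.inner_sum, orthonormal_eigenH.inner_sum, two_mul]
  refine add_le_add (Finset.sum_le_sum fun k _ => ?_) (Finset.sum_le_sum fun k _ => ?_)
  · simp only [conj_trivial]
    nlinarith [one_le_lam k.2, sq_nonneg (a k)]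
  · simp only [conj_trivial]
    exact le_of_eq (by ring)

lemma norm_sum_eigenE_sq_le (s : Finset NZFreq) (a : NZFreq → ℝ) :
    ‖∑ k ∈ s, a k • eigenE k‖ ^ 2 ≤ 9 * ∑ k ∈ s, (lam k * a k) ^ 2 := by
  have h1 := norm_le_norm_A (∑ k ∈ s, a k • eigenE k)
  have h2 : ‖A (∑ k ∈ s, a k • eigenE k)‖ ^ 2 = ∑ k ∈ s, (lam k * a k) ^ 2 := by
    rw [← real_inner_self_eq_norm_sq, A_sum_eigenE, orthonormal_eigenH.inner_sum]
    refine Finset.sum_congr rfl fun k _ => ?_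
    simp only [conj_trivial]
    ring
  rw [← h2]
  calc _ ≤ (3 * ‖A (∑ k ∈ s, a k • eigenE k)‖) ^ 2 := by gcongr
    _ = _ := by ring

/-! ### Existence for the Stokes evolution equation -/

/-- Solve each mode by Duhamel and sum the eigenfunction series in `X_T`. The energy bound `D k` of
a mode controls both `λ y²` at every time and the integral of `(λ y)²`, hence the `V` and `E` parts
of the norm. It is summable because `ω₀ ∈ V` and `f ∈ L²(0,T;H)`, so the series satisfies the Cauchy
criterion. -/
lemma exists_isStokesSolution {T : ℝ} (hT : 0 ≤ T) (f : L2Time T H) (ω₀ : V) :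
    ∃ ω : X T, ω.path ⟨0, left_mem_Icc.2 hT⟩ = ω₀ ∧ IsStokesSolution f ω := by
  let φ : NZFreq → ℝ → ℝ := fun k => extend hT fun t => inner ℝ (eigenH k) (f t)
  have hφ : ∀ k, IntervalIntegrable (φ k) volume 0 T := fun k =>
    integrableOn_extend hT (integrable_of_memLp_two (memLp_inner_eigenH f k))
  have hφ2 : ∀ k, IntervalIntegrable (fun t => φ k t ^ 2) volume 0 T := fun k =>
    integrableOn_extend hT (memLp_inner_eigenH f k).integrable_sq
  choose y hy0 hy using fun k : NZFreq =>
    exists_scalar_solution hT (hφ k) (lam k) (inner ℝ (eigenH k) (V.toH ω₀))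
  have hyc : ∀ k, Continuous fun t : Icc (0 : ℝ) T => y k t := fun k =>
    continuousOn_iff_continuous_domRestrict.1 ((hy k).continuousOn hT)
  let D : NZFreq → ℝ := fun k => lam k * inner ℝ (eigenH k) (V.toH ω₀) ^ 2
    + ∫ t, inner ℝ (eigenH k) (f t) ^ 2 ∂timeMeasure T
  have hD0 : ∀ k, 0 ≤ D k := fun k =>
    add_nonneg (mul_nonneg (lam_nonneg _) (sq_nonneg _)) (integral_nonneg fun _ => sq_nonneg _)
  have hDs : Summable D := (summable_lam_mul_sq ω₀).add (hasSum_integral_sq f).summable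
  have hen : ∀ k : NZFreq, ∀ t ∈ Icc 0 T, lam k * y k t ^ 2 + ∫ s in 0..t, (lam k * y k s) ^ 2 ≤ D k := by
    intro k t ht
    have h1 := scalar_energy hT (μ := 0) (hy k) (hφ2 k) ht
    simp only [add_zero, neg_zero, zero_mul, Real.exp_zero, one_mul, hy0] at h1
    refine h1.trans (add_le_add le_rfl ?_)
    rw [integral_extend hT]
    exact intervalIntegral.integral_mono_interval le_rfl ht.1 ht.2
      (ae_of_all _ fun _ => sq_nonneg _) (hφ2 k)
  have hen1 : ∀ k : NZFreq, ∀ t ∈ Icc 0 T, lam k * y k t ^ 2 ≤ D k := fun k t ht => by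
    have h1 : 0 ≤ ∫ s in 0..t, (lam k * y k s) ^ 2 :=
      intervalIntegral.integral_nonneg ht.1 fun _ _ => sq_nonneg _
    linarith [hen k t ht]
  have hen2 : ∀ k : NZFreq, ∫ t : Icc (0 : ℝ) T, (lam k * y k t) ^ 2 ∂timeMeasure T ≤ D k := fun k => by
    have h1 := hen k T (right_mem_Icc.2 hT)
    have h2 : ∫ t : Icc (0 : ℝ) T, (lam k * y k t) ^ 2 ∂timeMeasure T
        = ∫ s in 0..T, (lam k * y k s) ^ 2 := by
      rw [integral_extend hT]
      refine intervalIntegral.integral_congr fun t ht => ?_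
      rw [uIcc_of_le hT] at ht
      simp only [extend, projIcc_of_mem hT ht]
    rw [h2]
    linarith [mul_nonneg (lam_nonneg k) (sq_nonneg (y k T))]
  let c : NZFreq → C(Icc (0 : ℝ) T, E) := fun k =>
    ⟨fun t => y k t • eigenE k, (hyc k).smul continuous_const⟩
  -- The factor 9 serves both parts of the norm: 2 would do for the sup in `V`, 9 is needed for
  -- `L²(0,T;E)`.
  have hbound : ∀ s : Finset NZFreq, ‖∑ k ∈ s, ofPath (c k)‖ ≤ Real.sqrt (9 * ∑ k ∈ s, D k) := by
    intro s
    have hs0 : 0 ≤ ∑ k ∈ s, D k := Finset.sum_nonneg fun k _ => hD0 k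
    have hcs : ∀ t, (∑ k ∈ s, c k) t = ∑ k ∈ s, y k t • eigenE k := fun t => by
      simp [c, ContinuousMap.sum_apply]
    rw [ofPath_sum]
    refine norm_ofPath_le (fun t => ?_) ?_
    · rw [hcs]
      refine (norm_toV_sum_eigenE_sq_le s _).trans ?_
      have := Finset.sum_le_sum fun k (_ : k ∈ s) => hen1 k t t.2
      linarith
    · have hquad : ∀ k : NZFreq, Integrable (fun t : Icc (0 : ℝ) T => (lam k * y k t) ^ 2) (timeMeasure T) :=
        fun k => Continuous.integrable_of_hasCompactSupport
          (((hyc k).const_smul (lam k)).pow 2) (HasCompactSupport.of_compactSpace _)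
      calc ∫ t, ‖(∑ k ∈ s, c k) t‖ ^ 2 ∂timeMeasure T
          ≤ ∫ t : Icc (0 : ℝ) T, 9 * ∑ k ∈ s, (lam k * y k t) ^ 2 ∂timeMeasure T := by
            refine integral_mono ?_ ((integrable_finsetSum s fun k _ => hquad k).const_mul 9)
              fun t => ?_
            · exact Continuous.integrable_of_hasCompactSupport (by fun_prop)
                (HasCompactSupport.of_compactSpace _)
            · simp only [hcs]
              exact norm_sum_eigenE_sq_le s _
        _ = 9 * ∑ k ∈ s, ∫ t : Icc (0 : ℝ) T, (lam k * y k t) ^ 2 ∂timeMeasure T := by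
            rw [integral_const_mul, integral_finsetSum s fun k _ => hquad k]
        _ ≤ 9 * ∑ k ∈ s, D k := by
            gcongr with k
            exact hen2 k
  have hsum : Summable fun k => ofPath (c k) := by
    rw [summable_iff_vanishing_norm]
    intro ε hε
    obtain ⟨s, hs⟩ := summable_iff_vanishing_norm.1 hDs (ε ^ 2 / 9) (by positivity)
    refine ⟨s, fun t ht => (hbound t).trans_lt ?_⟩
    rw [Real.sqrt_lt' hε]
    have h1 := (le_abs_self _).trans_lt (hs t ht)
    linarith
  set ω : X T := ∑' k, ofPath (c k) with hω
  have hcoord : ∀ (t : Icc (0 : ℝ) T) (l : NZFreq),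
      inner ℝ (eigenH l) (V.toH (ω.path t)) = y l t := by
    intro t l
    have h1 := hsum.hasSum.mapL ((innerSL ℝ (eigenH l)).comp (V.toH.comp (X.evalL t)))
    have h2 : ∀ k, ((innerSL ℝ (eigenH l)).comp (V.toH.comp (X.evalL t))) (ofPath (c k))
        = if k = l then y l t else 0 := by
      intro k
      change inner ℝ (eigenH l) (E.toH (y k t • eigenE k)) = _
      rw [map_smul, inner_smul_right, toH_eigenE, orthonormal_iff_ite.1 orthonormal_eigenH]
      by_cases h : k = l
      · subst h; simp
      · simp [h, Ne.symm h]
    simp only [h2] at h1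
    exact h1.unique (hasSum_ite_eq l (y l t))
  have hstart : ω.path ⟨0, left_mem_Icc.2 hT⟩ = ω₀ :=
    V.toH_injective (ext_inner_eigenH fun k => by rw [hcoord, hy0])
  -- The equation itself defines the candidate derivative; that it is the derivative is then checked
  -- in each coordinate.
  let w : L2Time T H := f - A.compLpL 2 (timeMeasure T) ω.toE
  have hw : ∀ᵐ t ∂timeMeasure T, w t = f t - A (ω.toE t) := by
    filter_upwards [Lp.coeFn_sub f (A.compLpL 2 (timeMeasure T) ω.toE),
      A.coeFn_compLpL (p := 2) ω.toE] with t h1 h2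
    rw [h1, Pi.sub_apply, h2]
  refine ⟨ω, hstart, w, fun s t hst => ext_inner_eigenH fun k => ?_, ?_⟩
  · have hwi : Integrable w (timeMeasure T) := integrable_of_memLp_two (Lp.memLp w)
    rw [← integral_inner hwi.integrableOn, inner_sub_right, hcoord, hcoord]
    have h1 : ∫ r in Ioc s t, inner ℝ (eigenH k) (w r) ∂timeMeasure T
        = ∫ r in Ioc s t, (inner ℝ (eigenH k) (f r) - lam k * y k r) ∂timeMeasure T := by
      refine integral_congr_ae (ae_restrict_of_ae ?_)
      filter_upwards [hw, ω.ae_eq] with r h1 h2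
      rw [h1, inner_sub_right, inner_eigenH_A, ← hcoord, ← h2]
      rfl
    have h2 : ∫ r in (s : ℝ)..t, extend hT (fun r => inner ℝ (eigenH k) (f r) - lam k * y k r) r
        = ∫ r in (s : ℝ)..t, (φ k r - lam k * y k r) := by
      refine intervalIntegral.integral_congr fun r hr => ?_
      rw [uIcc_of_le (show (s : ℝ) ≤ t from hst)] at hr
      have hr' : r ∈ Icc 0 T := ⟨s.2.1.trans hr.1, hr.2.trans t.2.2⟩
      simp only [φ, extend, projIcc_of_mem hT hr']
    rw [h1, setIntegral_extend hT _ hst, h2, (hy k).2 t t.2, (hy k).2 s s.2,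
      ← intervalIntegral.integral_interval_sub_left ((hy k).intervalIntegrable t.2)
        ((hy k).intervalIntegrable s.2)]
    ring
  · filter_upwards [hw] with t ht
    rw [ht, sub_add_cancel]

/-! ### The linearized equation on a bounded interval -/

/-- The lower order part of the linearized operator along `ω ∈ X_T`. -/
abbrev lowerOrderPath {T : ℝ} (ubar : E) (ω : X T) : L2Time T H :=
  (lowerOrder ubar).compLpL 2 (timeMeasure T) ω.toE

lemma isLinearizedSolution_iff (ubar : E) {T : ℝ} (hT : 0 < T) (U : L2Time T H) (ω₀ : V)
    (ω : X T) : IsLinearizedSolution ubar hT U ω₀ ω ↔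
      ω.path ⟨0, left_mem_Icc.2 hT.le⟩ = ω₀ ∧ IsStokesSolution (U + lowerOrderPath ubar ω) ω := by
  refine and_congr_right fun _ => exists_congr fun w => and_congr_right fun _ => ?_
  have h : ∀ᵐ t ∂timeMeasure T,
      (U + lowerOrderPath ubar ω) t = U t + lowerOrder ubar (ω.toE t) := by
    filter_upwards [Lp.coeFn_add U (lowerOrderPath ubar ω),
      (lowerOrder ubar).coeFn_compLpL (p := 2) ω.toE] with t h1 h2
    rw [h1, Pi.add_apply, h2]
  refine Filter.eventually_congr ?_
  filter_upwards [h] with t ht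
  rw [ht, lowerOrder_apply, ← sub_eq_zero, ← sub_eq_zero (a := w t + A (ω.toE t))]
  refine Eq.congr_left ?_
  abel

lemma norm_weight_lowerOrderPath_le {T : ℝ} {ubar : E} {μ : ℝ}
    (hK : ∀ ω, ‖lowerOrder ubar ω‖ ≤ 2⁻¹ * ‖shiftedA μ ω‖) (ω : X T) :
    ‖weight μ (lowerOrderPath ubar ω)‖ ≤ 2⁻¹ * ‖weight μ (shiftedPath μ ω)‖ := by
  refine norm_weight_le μ ?_
  filter_upwards [(lowerOrder ubar).coeFn_compLpL (p := 2) ω.toE,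
    (shiftedA μ).coeFn_compLpL (p := 2) ω.toE] with t h1 h2
  rw [h1, h2]
  exact hK _

lemma lowerOrderPath_sub {T : ℝ} (ubar : E) (ω ω' : X T) :
    lowerOrderPath ubar (ω - ω') = lowerOrderPath ubar ω - lowerOrderPath ubar ω' := by
  rw [lowerOrderPath, X.toE_sub, map_sub]

lemma linearizedSolution_unique {ubar : E} {T : ℝ} {hT : 0 < T} {U : L2Time T H} {ω₀ : V}
    {ω ω' : X T} (h : IsLinearizedSolution ubar hT U ω₀ ω)
    (h' : IsLinearizedSolution ubar hT U ω₀ ω') : ω = ω' := by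
  obtain ⟨μ, hμ, hK⟩ := exists_norm_lowerOrder_le ubar
  rw [isLinearizedSolution_iff] at h h'
  set δ := ω - ω' with hδ
  have h0 : δ.path ⟨0, left_mem_Icc.2 hT.le⟩ = 0 := by
    change ω.path _ - ω'.path _ = 0
    rw [h.1, h'.1, sub_self]
  have hs : IsStokesSolution (lowerOrderPath ubar δ) δ := by
    have := h.2.sub h'.2
    rwa [add_sub_add_left_eq_sub, ← lowerOrderPath_sub] at this
  have h1 := hs.norm_weight_shiftedPath_le hT.le h0 hμ
  have h2 := norm_weight_lowerOrderPath_le hK δ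
  -- The energy estimate and the smallness of the lower order part bound this norm by half of
  -- itself.
  have h3 : weight μ (shiftedPath μ δ) = 0 := by
    rw [← norm_eq_zero]
    linarith [norm_nonneg (weight μ (shiftedPath μ δ))]
  have hE : ∀ᵐ t ∂timeMeasure T, δ.toE t = 0 := by
    have h4 := coeFn_weight μ (shiftedPath μ δ)
    rw [h3] at h4
    filter_upwards [h4, Lp.coeFn_zero H 2 (timeMeasure T),
      (shiftedA μ).coeFn_compLpL (p := 2) δ.toE] with t h5 h6 h7
    rw [h6, h7, Pi.zero_apply, eq_comm, smul_eq_zero] at h5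
    have h8 := h5.resolve_left (Real.exp_pos _).ne'
    have h9 := norm_A_le hμ (δ.toE t)
    rw [h8, norm_zero] at h9
    have h10 := norm_le_norm_A (δ.toE t)
    rw [← norm_eq_zero]
    linarith [norm_nonneg (δ.toE t)]
  -- Vanishing in `E` at almost every time makes the time derivative zero; with zero initial value
  -- the path vanishes at every time.
  have hP : ∀ t, δ.path t = 0 := by
    obtain ⟨w, hw, he⟩ := hs
    intro t
    have h4 := hw ⟨0, left_mem_Icc.2 hT.le⟩ t t.2.1
    have h5 : ∫ r in Ioc (⟨0, left_mem_Icc.2 hT.le⟩ : Icc (0 : ℝ) T) t, w r ∂timeMeasure T = 0 := by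
      refine integral_eq_zero_of_ae (ae_restrict_of_ae ?_)
      filter_upwards [he, hE, (lowerOrder ubar).coeFn_compLpL (p := 2) δ.toE] with r h6 h7 h8
      rw [h8, h7, map_zero, map_zero, add_zero] at h6
      exact h6
    rw [h5, h0, map_zero, sub_zero] at h4
    exact V.toH_injective (by rw [h4, map_zero])
  have hz : δ = 0 := by
    refine Subtype.ext (Prod.ext (ContinuousMap.ext hP) ?_)
    refine Lp.ext ?_
    filter_upwards [hE, Lp.coeFn_zero E 2 (timeMeasure T)] with t h4 h5
    exact h4.trans h5.symm
  exact sub_eq_zero.1 hz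

/-- Banach's fixed point theorem for the Stokes right-hand side `f` rather than for `ω`: the initial
value is then built into `sol`. The unknown is `g = e^{-μt} f`, so that the weighted norm of `f` is
the usual norm of `g`. -/
lemma exists_linearizedSolution (ubar : E) {T : ℝ} (hT : 0 < T) (U : L2Time T H) (ω₀ : V) :
    ∃ ω : X T, IsLinearizedSolution ubar hT U ω₀ ω := by
  obtain ⟨μ, hμ, hK⟩ := exists_norm_lowerOrder_le ubar
  choose sol hsol0 hsol using fun f : L2Time T H => exists_isStokesSolution hT.le f ω₀
  let Φ : L2Time T H → L2Time T H := fun g =>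
    weight μ (U + lowerOrderPath ubar (sol (weight (-μ) g)))
  have hΦ : ContractingWith 2⁻¹ Φ := by
    refine ⟨by rw [← NNReal.coe_lt_coe]; norm_num, LipschitzWith.of_dist_le_mul fun g g' => ?_⟩
    set δ := sol (weight (-μ) g) - sol (weight (-μ) g') with hδ
    have h0 : δ.path ⟨0, left_mem_Icc.2 hT.le⟩ = 0 := by
      change (sol _).path _ - (sol _).path _ = 0
      rw [hsol0, hsol0, sub_self]
    have hs := (hsol (weight (-μ) g)).sub (hsol (weight (-μ) g'))
    rw [← weight_sub] at hs
    have h1 := hs.norm_weight_shiftedPath_le hT.le h0 hμ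
    rw [weight_weight_neg] at h1
    have h2 := norm_weight_lowerOrderPath_le hK δ
    rw [dist_eq_norm, dist_eq_norm, ← weight_sub, add_sub_add_left_eq_sub, ← lowerOrderPath_sub,
      NNReal.coe_inv, NNReal.coe_ofNat]
    linarith
  have : Nonempty (L2Time T H) := ⟨0⟩
  set g := hΦ.fixedPoint
  have hg : Φ g = g := hΦ.fixedPoint_isFixedPt
  refine ⟨sol (weight (-μ) g), (isLinearizedSolution_iff _ _ _ _ _).2 ⟨hsol0 _, ?_⟩⟩
  have h1 : U + lowerOrderPath ubar (sol (weight (-μ) g)) = weight (-μ) g :=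
    weight_injective μ (by rw [weight_weight_neg]; exact hg)
  rw [h1]
  exact hsol _

/-! ### Restriction in time -/

section

variable {T T₂ : ℝ}

/-- The inclusion of `[0, T]` into `[0, T₂]`. -/
abbrev timeIncl (h : T ≤ T₂) : Icc (0 : ℝ) T → Icc (0 : ℝ) T₂ := inclusion (Icc_subset_Icc_right h)

lemma continuous_timeIncl (h : T ≤ T₂) : Continuous (timeIncl h) := continuous_inclusion _

/-- The inequality suffices to carry almost-everywhere statements and square integrability from the
longer interval to the shorter one. -/
lemma map_timeIncl_le (h : T ≤ T₂) : (timeMeasure T).map (timeIncl h) ≤ timeMeasure T₂ := by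
  refine Measure.le_iff.2 fun s hs => ?_
  rw [Measure.map_apply (continuous_timeIncl h).measurable hs,
    Measure.comap_apply _ Subtype.val_injective
      (fun s hs => measurableSet_Icc.subtype_image hs) _ hs,
    Measure.comap_apply _ Subtype.val_injective
      (fun s hs => measurableSet_Icc.subtype_image hs) _
      ((continuous_timeIncl h).measurable hs)]
  refine measure_mono ?_
  rintro _ ⟨x, hx, rfl⟩
  exact ⟨timeIncl h x, hx, rfl⟩

lemma ae_timeIncl (h : T ≤ T₂) {p : Icc (0 : ℝ) T₂ → Prop} (hp : ∀ᵐ t ∂timeMeasure T₂, p t) :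
    ∀ᵐ t ∂timeMeasure T, p (timeIncl h t) :=
  ae_of_ae_map (continuous_timeIncl h).measurable.aemeasurable
    (Measure.absolutelyContinuous_of_le (map_timeIncl_le h) |>.ae_le hp)

lemma memLp_timeIncl (h : T ≤ T₂) {F : Type} [NormedAddCommGroup F] (f : L2Time T₂ F) :
    MemLp (fun t => f (timeIncl h t)) 2 (timeMeasure T) :=
  ((Lp.memLp f).mono_measure (map_timeIncl_le h)).comp_of_map
    (continuous_timeIncl h).measurable.aemeasurable

/-- The restriction of an element of `L²(0, T₂; F)` to `[0, T]`. -/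
def restrictLp (h : T ≤ T₂) {F : Type} [NormedAddCommGroup F] (f : L2Time T₂ F) : L2Time T F :=
  (memLp_timeIncl h f).toLp _

lemma coeFn_restrictLp (h : T ≤ T₂) {F : Type} [NormedAddCommGroup F] (f : L2Time T₂ F) :
    ∀ᵐ t ∂timeMeasure T, restrictLp h f t = f (timeIncl h t) := (memLp_timeIncl h f).coeFn_toLp

/-- The restriction of an element of `X_T₂` to `[0, T]`. -/
def X.restrict (h : T ≤ T₂) (ω : X T₂) : X T :=
  ⟨(ω.path.comp ⟨timeIncl h, continuous_timeIncl h⟩, restrictLp h ω.toE), by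
    change ∀ᵐ t ∂timeMeasure T, E.toV (restrictLp h ω.toE t) = ω.path (timeIncl h t)
    filter_upwards [coeFn_restrictLp h ω.toE, ae_timeIncl h ω.ae_eq] with t h1 h2
    rw [h1, h2]⟩

lemma X.restrict_path (h : T ≤ T₂) (ω : X T₂) (t : Icc (0 : ℝ) T) :
    (ω.restrict h).path t = ω.path (timeIncl h t) := rfl

lemma hasTimeDeriv_restrict (hT : 0 ≤ T) (h : T ≤ T₂) {ω : X T₂} {w : L2Time T₂ H}
    (hw : HasTimeDeriv ω.path w) : HasTimeDeriv (ω.restrict h).path (restrictLp h w) := by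
  intro s t hst
  rw [X.restrict_path, X.restrict_path, hw _ _ (show timeIncl h s ≤ timeIncl h t from hst),
    integral_congr_ae (ae_restrict_of_ae (coeFn_restrictLp h w)),
    setIntegral_extend hT _ hst, setIntegral_extend (hT.trans h) _
      (show timeIncl h s ≤ timeIncl h t from hst)]
  refine intervalIntegral.integral_congr fun r hr => ?_
  change r ∈ uIcc (s : ℝ) t at hr
  rw [uIcc_of_le (show (s : ℝ) ≤ t from hst)] at hr
  have hr' : r ∈ Icc 0 T := ⟨s.2.1.trans hr.1, hr.2.trans t.2.2⟩
  simp only [extend, projIcc_of_mem hT hr', projIcc_of_mem (hT.trans h) (Icc_subset_Icc_right h hr')]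

lemma IsLinearizedSolution.restrict {ubar : E} (hT : 0 < T) {hT₂ : 0 < T₂} (h : T ≤ T₂)
    {U : L2Time T H} {U' : L2Time T₂ H} (hU : ∀ᵐ t ∂timeMeasure T, U' (timeIncl h t) = U t)
    {ω₀ : V} {ω : X T₂} (hω : IsLinearizedSolution ubar hT₂ U' ω₀ ω) :
    IsLinearizedSolution ubar hT U ω₀ (ω.restrict h) := by
  obtain ⟨h0, w, hw, he⟩ := hω
  refine ⟨h0, restrictLp h w, hasTimeDeriv_restrict hT.le h hw, ?_⟩
  filter_upwards [ae_timeIncl h he, hU, coeFn_restrictLp h w, coeFn_restrictLp h ω.toE]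
    with t h1 h2 h3 h4
  have h5 : (ω.restrict h).toE t = ω.toE (timeIncl h t) := h4
  rw [h3, h5, h1, h2]

end

/-! ### The linearized equation on the half line -/

lemma existsUnique_global (ubar : E) (U : ℝ → H)
    (hU : ∀ T : ℝ, MemLp (fun t : Icc (0 : ℝ) T => U t) 2 (timeMeasure T)) (ω₀ : V) :
    ∃! ω : C(Ici (0 : ℝ), V), ∀ (T : ℝ) (hT : 0 < T), ∃ ωT : X T,
      (∀ t : Icc (0 : ℝ) T, ωT.path t = ω ⟨t, t.2.1⟩) ∧
      IsLinearizedSolution ubar hT (hU T).toLp ω₀ ωT := by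
  choose sol hsol using fun (T : ℝ) (hT : 0 < T) =>
    exists_linearizedSolution ubar hT (hU T).toLp ω₀
  have hle : ∀ (T T₂ : ℝ) (hT : 0 < T) (hT₂ : 0 < T₂) (h : T ≤ T₂) (t : Icc (0 : ℝ) T),
      (sol T₂ hT₂).path (timeIncl h t) = (sol T hT).path t := by
    intro T T₂ hT hT₂ h t
    have hr := (hsol T₂ hT₂).restrict hT h (U := (hU T).toLp) (by
      filter_upwards [ae_timeIncl h (hU T₂).coeFn_toLp, (hU T).coeFn_toLp] with t h1 h2
      rw [h1, h2])
    rw [← linearizedSolution_unique hr (hsol T hT), X.restrict_path]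
  have hag : ∀ (T T₂ : ℝ) (hT : 0 < T) (hT₂ : 0 < T₂) (t : ℝ) (h : t ∈ Icc 0 T)
      (h' : t ∈ Icc 0 T₂), (sol T hT).path ⟨t, h⟩ = (sol T₂ hT₂).path ⟨t, h'⟩ := by
    intro T T₂ hT hT₂ t h h'
    rcases le_total T T₂ with hl | hl
    · exact (hle T T₂ hT hT₂ hl ⟨t, h⟩).symm
    · exact hle T₂ T hT₂ hT hl ⟨t, h'⟩
  have hpos : ∀ t : Ici (0 : ℝ), 0 < (t : ℝ) + 1 := fun t => by
    have : (0 : ℝ) ≤ t := t.2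
    linarith
  -- Any positive horizon beyond `t` gives the same value. The horizon `t + 1` is positive even at
  -- `t = 0`, and it leaves room to the right of `t`, so that near `t` the function coincides with
  -- one fixed continuous path.
  let v : Ici (0 : ℝ) → V := fun t => (sol (t + 1) (hpos t)).path ⟨t, t.2, by linarith⟩
  have hv : ∀ (T : ℝ) (hT : 0 < T) (t : Icc (0 : ℝ) T), (sol T hT).path t = v ⟨t, t.2.1⟩ :=
    fun T hT t => hag _ _ _ _ _ _ _
  have hvc : Continuous v := by
    rw [continuous_iff_continuousAt]
    intro t
    have hT := hpos t
    have hc : Continuous fun s : Ici (0 : ℝ) => (sol (t + 1) hT).path (projIcc 0 _ hT.le s) :=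
      (sol (t + 1) hT).path.continuous.comp (continuous_projIcc.comp continuous_subtype_val)
    refine hc.continuousAt.congr ?_
    have : ∀ᶠ s : Ici (0 : ℝ) in nhds t, (s : ℝ) < t + 1 :=
      continuous_subtype_val.continuousAt.eventually_lt_const (by linarith)
    filter_upwards [this] with s hs
    have hs' : (s : ℝ) ∈ Icc 0 ((t : ℝ) + 1) := ⟨s.2, hs.le⟩
    rw [projIcc_of_mem _ hs', hv]
  refine ⟨⟨v, hvc⟩, fun T hT => ⟨sol T hT, hv T hT, hsol T hT⟩, fun ω hω => ?_⟩
  ext1 t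
  obtain ⟨ωT, h1, h2⟩ := hω (t + 1) (hpos t)
  have h3 := linearizedSolution_unique h2 (hsol (t + 1) (hpos t))
  have h4 := h1 ⟨t, t.2, by linarith⟩
  rw [h3] at h4
  exact h4.symm

end CNS

end

theorem mainTheorem2 :
    -- the products `(u · ∇) v` of elements of `E` are square integrable
    (∀ u v : E, MemLp (convection (E.toV u) (E.toV v)) 2 torusMeasure) ∧
    -- `ω ↦ G(ω)` is globally Lipschitz from `X_T` to `L²(0, T; H)`
    (∃ C₁ C₂ C₃ : ℝ, 0 < C₁ ∧ 0 < C₂ ∧ 0 < C₃ ∧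
      ∀ ubar : E, IsSteadyState ubar → ∀ T : ℝ, 0 < T → ∀ U : L2Time T H,
        ∃ Φ : X T → L2Time T H,
          (∀ ω : X T, ∀ᵐ t ∂timeMeasure T, Φ ω t = G ubar (U t) (ω.toE t)) ∧
          ∀ ω₁ ω₂ : X T, ‖Φ ω₁ - Φ ω₂‖ ≤
            (C₁ * ‖E.grad ubar‖ ^ 2 + C₂ * ‖ubar‖
              + 2 * C₃ * ‖E.toH ubar‖ * ‖E.grad ubar‖) * ‖ω₁ - ω₂‖) ∧
    -- unique solution on `[0, T]`, for every `T > 0`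
    (∀ ubar : E, IsSteadyState ubar → ∀ (T : ℝ) (hT : 0 < T) (U : L2Time T H) (ω₀ : V),
      ∃! ω : X T, IsLinearizedSolution ubar hT U ω₀ ω) ∧
    -- unique solution on `[0, ∞)`, for a forcing that is square integrable on bounded intervals
    (∀ ubar : E, IsSteadyState ubar → ∀ (U : ℝ → H)
      (hU : ∀ T : ℝ, MemLp (fun t : Icc (0 : ℝ) T => U t) 2 (timeMeasure T)) (ω₀ : V),
      ∃! ω : C(Ici (0 : ℝ), V), ∀ (T : ℝ) (hT : 0 < T), ∃ ωT : X T,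
        (∀ t : Icc (0 : ℝ) T, ωT.path t = ω ⟨t, t.2.1⟩) ∧
        IsLinearizedSolution ubar hT (hU T).toLp ω₀ ωT) := by
  refine ⟨memLp_convection, ⟨1, 4 * embC + 1, 1, one_pos, by linarith [embC_nonneg], one_pos,
    fun ubar _ T _ U => exists_lipschitz_G ubar T U⟩, fun ubar _ T hT U ω₀ => ?_,
    fun ubar _ U hU ω₀ => existsUnique_global ubar U hU ω₀⟩
  obtain ⟨ω, hω⟩ := exists_linearizedSolution ubar hT U ω₀
  exact ⟨ω, hω, fun ω' hω' => linearizedSolution_unique hω' hω⟩
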